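/- Let $\Theta=(\theta_m)_{m\ge 1}$ be a sequence of real numbers $\theta_m\ge 0$ and let $A_n\subset\{1,\dots,n\}$ for every $n$. Equip the symmetric group $S_n$ with the $A_n$-weighted measure $$\mathbb P^{(A_n)}_\Theta[\sigma]=\frac{1}{h_n\,n!}\prod_{i=1}^{\ell}\theta_{\lambda_i}\mathbf 1_{\{\lambda_i\in A_n\}},\qquad h_n=\frac1{n!}\sum_{\sigma\in S_n}\prod_{i=1}^{\ell}\theta_{\lambda_i}\mathbf 1_{\{\lambda_i\in A_n\}},$$ where $\lambda=(\lambda_1,\dots,\lambda_\ell)$ is the cycle type of $\sigma$ (fixed points included). Let $\mathbb E^{(A_n)}_\Theta$ be the expectation with respect to this measure, and let $T=\ell$ be the total number of cycles. Put $D_n=\{1,\dots,n\}\setminus A_n$, put $d_n=\max D_n$ if $D_n\ne\emptyset$ and $d_n=1$ otherwise, and put $L_{D_n}(t)=\sum_{m\in D_n}\frac{\theta_m}{m}t^m$. Let $r,\vartheta>0$ and $K\in\mathbb R$. Assume that $g_\Theta(t)=\sum_{m\ge1}\frac{\theta_m}{m}t^m$ belongs to the class $\mathcal F(r,\vartheta,K)$,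 that is: for some $R>r$ and $0<\phi<\frac\pi2$, the series $g_\Theta$ converges near $0$ and extends to a holomorphic function on $$\Delta_0=\{z\in\mathbb C:\ |z|<R,\ z\ne r,\ |\arg(z-r)|>\phi\},$$ and $$g_\Theta(t)=\vartheta\log\Big(\frac1{1-t/r}\Big)+K+O(t-r)\qquad\text{as } t\to r,\ t\in\Delta_0 .$$ Assume moreover that $C\log n-\frac{n}{d_n}\to-\infty$ as $n\to\infty$ for every $C\in\mathbb R$. Then $h_n>0$ for all sufficiently large $n$ (so that the measure is well defined), and, as $n\to\infty$, $$\mathbb E^{(A_n)}_\Theta\big[e^{isT}\big]=n^{\vartheta(e^{is}-1)}\,e^{(K-L_{D_n}(r))(e^{is}-1)}\left(\frac{\Gamma(\vartheta)}{\Gamma(e^{is}\vartheta)}+O\Big(\frac{d_n}{n}\Big)\right)$$ uniformly in $s\in\mathbb C$ for bounded $\Re(is)$: for every $B$ there are a constant $C_B$ and an $N_B$ such that, for all $n\ge N_B$ and all $s\in\mathbb C$ with $|\Re(is)|\le B$, the term $O(d_n/n)$ has modulus at most $C_B\,d_n/n$. Here $1/\Gamma$ is the entire function that vanishes at the poles of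 $\Gamma$. -/

import Mathlib

open Filter Topology Asymptotics

noncomputable section

namespace AWeighted

/-- Product over all cycles of `σ` (fixed points included) of `θ_m 1_{m ∈ A}`, where `m` is the
cycle length. `σ.partition` is the cycle type of `σ` as a partition of `n`. -/
def weight (θ : ℕ → ℝ) (A : Finset ℕ) {n : ℕ} (σ : Equiv.Perm (Fin n)) : ℝ :=
  (σ.partition.parts.map (fun m => if m ∈ A then θ m else 0)).prod

/-- The normalization constant `h_n(A)`. -/
def h (θ : ℕ → ℝ) (A : Finset ℕ) (n : ℕ) : ℝ :=
  (1 / (n.factorial : ℝ)) * ∑ σ : Equiv.Perm (Fin n), weight θ A σ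

/-- The `A`-weighted measure of a permutation `σ ∈ S_n`. -/
def prob (θ : ℕ → ℝ) (A : Finset ℕ) {n : ℕ} (σ : Equiv.Perm (Fin n)) : ℝ :=
  1 / (h θ A n * (n.factorial : ℝ)) * weight θ A σ

/-- Expectation of `f : S_n → ℂ` with respect to the `A`-weighted measure. -/
def expect (θ : ℕ → ℝ) (A : Finset ℕ) {n : ℕ} (f : Equiv.Perm (Fin n) → ℂ) : ℂ :=
  ∑ σ : Equiv.Perm (Fin n), (prob θ A σ : ℂ) * f σ

/-- `C_m(σ)`, the number of cycles of length `m` of `σ`. -/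
def cycleCount {n : ℕ} (m : ℕ) (σ : Equiv.Perm (Fin n)) : ℕ :=
  σ.partition.parts.count m

/-- `T(σ)`, the total number of cycles of `σ`. -/
def totalCycles {n : ℕ} (σ : Equiv.Perm (Fin n)) : ℕ :=
  ∑ m ∈ Finset.Icc 1 n, cycleCount m σ

/-- `D_n = {1, …, n} \ A_n`. -/
def D (A : ℕ → Finset ℕ) (n : ℕ) : Finset ℕ := Finset.Icc 1 n \ A n

/-- `d_n = max D_n` if `D_n` is nonempty, and `1` otherwise. -/
def d (A : ℕ → Finset ℕ) (n : ℕ) : ℕ :=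
  if hD : (D A n).Nonempty then (D A n).max' hD else 1

/-- `L_S(t) = ∑_{m ∈ S} (θ_m / m) t ^ m` for a finite set `S`, at a real point `t`. -/
def L (θ : ℕ → ℝ) (S : Finset ℕ) (t : ℝ) : ℝ :=
  ∑ m ∈ S, θ m / (m : ℝ) * t ^ m

/-- The domain `Δ₀(r, R, φ)`. -/
def Delta0 (r R φ : ℝ) : Set ℂ :=
  {z : ℂ | ‖z‖ < R ∧ z ≠ (r : ℂ) ∧ φ < |Complex.arg (z - (r : ℂ))|}

/-- The class `ℱ(r, ϑ, K)` of functions. On `Δ₀` the argument `1 / (1 - t / r)` avoids the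
negative real axis, so that the principal branch of the logarithm is holomorphic there. -/
def ClassF (r ϑ K : ℝ) : Set (ℂ → ℂ) :=
  {g : ℂ → ℂ | ∃ R φ : ℝ, r < R ∧ 0 < φ ∧ φ < Real.pi / 2 ∧
    DifferentiableOn ℂ g (Delta0 r R φ) ∧
    (fun t : ℂ => g t - ((ϑ : ℂ) * Complex.log (1 / (1 - t / (r : ℂ))) + (K : ℂ)))
      =O[𝓝[Delta0 r R φ] (r : ℂ)] (fun t : ℂ => t - (r : ℂ))}

/-- The generating function `g_Θ(t) = ∑_{m ≥ 1} (θ_m / m) t ^ m` belongs to `ℱ(r, ϑ, K)`: the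
series converges near `0`, and its sum continues analytically to a member of `ℱ(r, ϑ, K)`.
(The term of index `m = 0` is zero, whatever `θ 0` is.) -/
def GenFunMem (θ : ℕ → ℝ) (r ϑ K : ℝ) : Prop :=
  ∃ g ∈ ClassF r ϑ K, ∀ᶠ t in 𝓝 (0 : ℂ),
    HasSum (fun m : ℕ => (θ m : ℂ) / (m : ℂ) * t ^ m) (g t)

end AWeighted

end

/-! Put `w = e^{is}`. By the exponential formula `h_n E[w^T]` is the coefficient of `t^n` in `exp(w
(g_Θ(t) - L_{D_n}(t)))`; terms of degree above `n` do not matter. The formula comes from a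
recurrence: `cycleSum` satisfies it by removal of one part of a partition (`mul_cycleSum`), the
Taylor coefficients of an exponential by differentiation (`taylorCoeff_exp_recurrence`).

With the singularity rescaled to `1`, the function becomes `e^{(K - L_{D_n}(r)) w} (1 - t)^{-wϑ}
exp(w (q(t) - p_n(t)))`, where `q(t) = O(t - 1)` and `p_n(t) = L_{D_n}(rt) - L_{D_n}(r)` is
`shiftedPoly`. With the last factor replaced by `1`, the coefficients are `n^{wϑ-1} (1/Γ(wϑ) +
O(1/n))`, uniformly for bounded `w` (`exists_norm_scaledPowCoeff_sub_le`). It remains to see that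
the difference `errorFun` contributes only `O(d_n/n)` relative to `n^{Re(wϑ)-1}`.

This is a Cauchy estimate (`norm_taylorCoeff_le`). As `p_n` varies with `n`, the contour leaves the
unit disc only up to radius `e^{δ/d_n}`, where `t^m` stays bounded for `m ≤ d_n`. Near `1` the
exponent is `O(d_n |t - 1|)`, and the additional factor `|t - 1|` is worth `1/n`. On the outer
circle `errorFun` is at most a power of `n`, whereas `|t|^{-n} = e^{-δ n/d_n}` is smaller than every
power by the growth hypothesis. The bounds on `p_n` rest on `∑_{m ≤ d} c_m = O(d)` and `∑_{m ≤ d}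
c_m/m = O(1 + log d)` with `c_m = θ_m r^m`; both follow from `θ_m ≥ 0` and the behaviour of the
series on the real axis.

Dividing the asymptotics for `w` by those for `w = 1` gives the theorem; `h_n > 0` eventually
because `1/Γ(ϑ) > 0`. -/

namespace AWeighted

/-! ### Weighted sums over permutations and their recurrence -/

/-- The weight `∏ (x_m / m) ^ c_m / c_m!` of a multiset in which `m` occurs `c_m` times. -/
noncomputable def multisetWeight (x : ℕ → ℂ) (s : Multiset ℕ) : ℂ :=
  (s.map x).prod / ((s.prod : ℂ) * ∏ m ∈ s.toFinset, ((s.count m).factorial : ℂ))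

/-- The sum of the weights of the partitions of `n`. -/
noncomputable def cycleSum (x : ℕ → ℂ) (n : ℕ) : ℂ :=
  ∑ p : n.Partition, multisetWeight x p.parts

/-- `Equiv.Perm.cycleType` omits fixed points, so the parts equal to `1` are split off; their number
`k` equals `card α - s.sum`, and `k!` is the factor belonging to the part `1`. -/
theorem card_perm_partition_eq {α : Type*} [Fintype α] [DecidableEq α]
    (p : (Fintype.card α).Partition) :
    (Finset.univ.filter (fun σ : Equiv.Perm α => σ.partition = p)).card *
      (p.parts.prod * ∏ m ∈ p.parts.toFinset, (p.parts.count m).factorial) =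
      (Fintype.card α).factorial := by
  classical
  set s := p.parts.filter (fun m => 2 ≤ m) with hs
  set k := p.parts.count 1 with hk
  have hsplit : p.parts = s + Multiset.replicate k 1 := by
    ext m
    rw [Multiset.count_add, Multiset.count_replicate, hs, Multiset.count_filter]
    rcases Nat.lt_trichotomy m 1 with h | h | h
    · have : m = 0 := by omega
      subst this
      simpa using fun h0 => (p.parts_pos h0).ne' rfl
    · subst h; simp [hk]
    · have : 2 ≤ m := h
      simp [this, show (1 : ℕ) ≠ m by omega]
  have hsum : s.sum + k = Fintype.card α := by
    have := p.parts_sum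
    rw [hsplit] at this
    simpa using this
  have hfil : (Finset.univ.filter (fun σ : Equiv.Perm α => σ.partition = p)) =
      Finset.univ.filter (fun σ : Equiv.Perm α => σ.cycleType = s) := by
    ext σ
    simp only [Finset.mem_filter, Finset.mem_univ, true_and]
    constructor
    · rintro rfl
      rw [hs, Equiv.Perm.filter_parts_partition_eq_cycleType]
    · intro h
      apply Nat.Partition.ext
      rw [Equiv.Perm.parts_partition, h, hsplit, ← Equiv.Perm.sum_cycleType, h]
      congr 2
      omega
  rw [hfil]
  have h2 := Equiv.Perm.card_of_cycleType_mul_eq α s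
  rw [if_pos ⟨by omega, fun a ha => (Multiset.mem_filter.1 ha).2⟩] at h2
  rw [← h2]
  congr 1
  have hprod : p.parts.prod = s.prod := by rw [hsplit]; simp
  have hkk : Fintype.card α - s.sum = k := by omega
  have hcnt : ∀ m ∈ s.toFinset, (s.count m).factorial = (p.parts.count m).factorial := by
    intro m hm
    have : 2 ≤ m := (Multiset.mem_filter.1 (Multiset.mem_toFinset.1 hm)).2
    rw [hs, Multiset.count_filter_of_pos this]
  have hfac : ∏ m ∈ p.parts.toFinset, (p.parts.count m).factorial =
      k.factorial * ∏ m ∈ s.toFinset, (s.count m).factorial := by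
    rw [Finset.prod_congr rfl hcnt, hk]
    have h1 : (1 : ℕ) ∉ s.toFinset := by
      simp [hs]
    rw [← Finset.prod_insert (f := fun m => (p.parts.count m).factorial) h1]
    apply Finset.prod_subset
    · intro m hm
      rw [Multiset.mem_toFinset, hsplit, Multiset.mem_add] at hm
      rw [Finset.mem_insert, Multiset.mem_toFinset]
      rcases hm with hm | hm
      · exact Or.inr hm
      · exact Or.inl (Multiset.eq_of_mem_replicate hm)
    · intro m _ hm
      rw [Multiset.mem_toFinset] at hm
      simp [Multiset.count_eq_zero_of_notMem hm]
  rw [hprod, hkk, hfac]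
  ring

theorem sum_perm_prod_eq (x : ℕ → ℂ) (n : ℕ) :
    ∑ σ : Equiv.Perm (Fin n), (σ.partition.parts.map x).prod =
      (n.factorial : ℂ) * cycleSum x n := by
  have key : ∑ σ : Equiv.Perm (Fin n), (σ.partition.parts.map x).prod =
      ((Fintype.card (Fin n)).factorial : ℂ) * cycleSum x (Fintype.card (Fin n)) := by
    rw [cycleSum, Finset.mul_sum, ← Finset.sum_fiberwise (s := Finset.univ)
      (g := fun σ : Equiv.Perm (Fin n) => σ.partition)]
    refine Finset.sum_congr rfl fun p _ => ?_
    rw [Finset.sum_congr rfl (g := fun _ => (p.parts.map x).prod)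
      (fun σ hσ => by rw [(Finset.mem_filter.1 hσ).2]), Finset.sum_const,
      ← card_perm_partition_eq p, multisetWeight]
    have h1 : (p.parts.prod : ℂ) ≠ 0 := by
      exact_mod_cast (Multiset.prod_pos fun m hm => p.parts_pos hm).ne'
    have h2 : (∏ m ∈ p.parts.toFinset, ((p.parts.count m).factorial : ℂ)) ≠ 0 :=
      Finset.prod_ne_zero_iff.2 fun m _ => by exact_mod_cast Nat.factorial_ne_zero _
    rw [Nat.cast_mul, Nat.cast_mul, Nat.cast_prod, nsmul_eq_mul]
    field_simp
  rw [key, Fintype.card_fin]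

/-- Adding a part `m` multiplies the product of the parts by `m` and the product of the factorials
by the new multiplicity of `m`; the prefactor cancels both. -/
theorem count_mul_multisetWeight_cons (x : ℕ → ℂ) (s : Multiset ℕ) {m : ℕ} (hm : 0 < m)
    (hs : ∀ i ∈ s, 0 < i) :
    (((m ::ₘ s).count m * m : ℕ) : ℂ) * multisetWeight x (m ::ₘ s) = x m * multisetWeight x s := by
  have hfac : ∏ i ∈ (m ::ₘ s).toFinset, (((m ::ₘ s).count i).factorial : ℂ) =
      ((s.count m : ℂ) + 1) * ∏ i ∈ s.toFinset, ((s.count i).factorial : ℂ) := by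
    have h1 : ∏ i ∈ s.toFinset, ((s.count i).factorial : ℂ) =
        ∏ i ∈ (m ::ₘ s).toFinset, ((s.count i).factorial : ℂ) := by
      apply Finset.prod_subset
      · intro i hi
        simp only [Multiset.mem_toFinset, Multiset.mem_cons] at hi ⊢
        exact Or.inr hi
      · intro i _ hi
        rw [Multiset.mem_toFinset] at hi
        simp [Multiset.count_eq_zero_of_notMem hi]
    have hmem : m ∈ (m ::ₘ s).toFinset := by simp
    rw [h1, ← Finset.mul_prod_erase _ _ hmem, ← Finset.mul_prod_erase _ _ hmem,
      Multiset.count_cons_self, Nat.factorial_succ]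
    have : ∏ i ∈ (m ::ₘ s).toFinset.erase m, (((m ::ₘ s).count i).factorial : ℂ) =
        ∏ i ∈ (m ::ₘ s).toFinset.erase m, ((s.count i).factorial : ℂ) := by
      refine Finset.prod_congr rfl fun i hi => ?_
      rw [Multiset.count_cons_of_ne (Finset.ne_of_mem_erase hi)]
    rw [this]
    push_cast
    ring
  have h1 : (s.prod : ℂ) ≠ 0 := by
    exact_mod_cast (Multiset.prod_pos hs).ne'
  have h2 : (∏ m ∈ s.toFinset, ((s.count m).factorial : ℂ)) ≠ 0 :=
    Finset.prod_ne_zero_iff.2 fun m _ => by exact_mod_cast Nat.factorial_ne_zero _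
  have h3 : (m : ℂ) ≠ 0 := by exact_mod_cast hm.ne'
  have h4 : (s.count m : ℂ) + 1 ≠ 0 := by exact_mod_cast (s.count m).succ_ne_zero
  rw [multisetWeight, multisetWeight, hfac, Multiset.map_cons, Multiset.prod_cons,
    Multiset.prod_cons, Multiset.count_cons_self, Nat.cast_mul, Nat.cast_mul, Nat.cast_succ]
  field_simp

theorem sum_count_mul_multisetWeight (x : ℕ → ℂ) {n m : ℕ} (hm : 0 < m) (hmn : m ≤ n) :
    ∑ p : n.Partition, ((p.parts.count m * m : ℕ) : ℂ) * multisetWeight x p.parts =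
      x m * cycleSum x (n - m) := by
  classical
  have h0 : ∑ p ∈ Finset.univ.filter (fun p : n.Partition => m ∈ p.parts),
      ((p.parts.count m * m : ℕ) : ℂ) * multisetWeight x p.parts =
      ∑ p : n.Partition, ((p.parts.count m * m : ℕ) : ℂ) * multisetWeight x p.parts := by
    apply Finset.sum_subset (Finset.subset_univ _)
    intro p _ hp
    have : m ∉ p.parts := by simpa using hp
    simp [Multiset.count_eq_zero_of_notMem this]
  rw [← h0, cycleSum, Finset.mul_sum]
  symm
  refine Finset.sum_bij (fun (p : (n - m).Partition) _ =>
    (⟨m ::ₘ p.parts, fun {i} hi => ?_, ?_⟩ : n.Partition)) ?_ ?_ ?_ ?_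
  · rcases Multiset.mem_cons.1 hi with rfl | h
    · exact hm
    · exact p.parts_pos h
  · rw [Multiset.sum_cons, p.parts_sum]; omega
  · intro p _; simp
  · intro p _ p' _ h
    have := congrArg Nat.Partition.parts h
    apply Nat.Partition.ext
    simpa using this
  · intro p hp
    have hp' : m ∈ p.parts := by simpa using hp
    refine ⟨⟨p.parts.erase m, fun {i} hi => p.parts_pos (Multiset.mem_of_mem_erase hi), ?_⟩,
      Finset.mem_univ _, ?_⟩
    · have := p.parts_sum
      rw [← Multiset.cons_erase hp', Multiset.sum_cons] at this
      omega
    · apply Nat.Partition.ext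
      exact Multiset.cons_erase hp'
  · intro p _
    exact (count_mul_multisetWeight_cons x p.parts hm fun i hi => p.parts_pos hi).symm

/-- Since `n = ∑ m * count m` for every partition of `n`, the left side splits over `m`; partitions
of `n` with a part `m` correspond to partitions of `n - m`. -/
theorem mul_cycleSum (x : ℕ → ℂ) (n : ℕ) :
    (n : ℂ) * cycleSum x n = ∑ m ∈ Finset.Icc 1 n, x m * cycleSum x (n - m) := by
  classical
  have h : ∀ m ∈ Finset.Icc 1 n, x m * cycleSum x (n - m) =
      ∑ p : n.Partition, ((p.parts.count m * m : ℕ) : ℂ) * multisetWeight x p.parts := by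
    intro m hm
    rw [Finset.mem_Icc] at hm
    rw [sum_count_mul_multisetWeight x (by omega) hm.2]
  rw [Finset.sum_congr rfl h, Finset.sum_comm, cycleSum, Finset.mul_sum]
  refine Finset.sum_congr rfl fun p _ => ?_
  rw [← Finset.sum_mul, ← Nat.cast_sum]
  congr 2
  have h1 : ∑ m ∈ Finset.Icc 1 n, p.parts.count m * m = p.parts.sum := by
    rw [Finset.sum_multiset_count]
    symm
    simp only [smul_eq_mul]
    apply Finset.sum_subset
    · intro m hm
      rw [Multiset.mem_toFinset] at hm
      rw [Finset.mem_Icc]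
      exact ⟨p.parts_pos hm, p.parts_sum ▸ Multiset.le_sum_of_mem hm⟩
    · intro m _ hm
      rw [Multiset.mem_toFinset] at hm
      simp [Multiset.count_eq_zero_of_notMem hm]
  rw [h1, p.parts_sum]

theorem cycleSum_zero (x : ℕ → ℂ) : cycleSum x 0 = 1 := by
  rw [cycleSum, Fintype.sum_unique]
  simp [multisetWeight]

/-- `cycleSum x n` depends only on `x 1, …, x n`, through a linear recurrence. -/
theorem eq_cycleSum_of_recurrence (x : ℕ → ℂ) (y : ℕ → ℂ) (N : ℕ) (h0 : y 0 = 1)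
    (hy : ∀ n, 1 ≤ n → n ≤ N → (n : ℂ) * y n = ∑ m ∈ Finset.Icc 1 n, x m * y (n - m)) :
    ∀ n, n ≤ N → y n = cycleSum x n := by
  intro n
  induction n using Nat.strong_induction_on with
  | _ n ih =>
    intro hn
    rcases Nat.eq_zero_or_pos n with rfl | hpos
    · rw [h0, cycleSum_zero]
    · have hn0 : (n : ℂ) ≠ 0 := by exact_mod_cast hpos.ne'
      apply mul_left_cancel₀ hn0
      rw [hy n hpos hn, mul_cycleSum]
      refine Finset.sum_congr rfl fun m hm => ?_
      rw [Finset.mem_Icc] at hm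
      rw [ih (n - m) (by omega) (by omega)]

theorem totalCycles_eq_card {n : ℕ} (σ : Equiv.Perm (Fin n)) :
    totalCycles σ = Multiset.card σ.partition.parts := by
  classical
  unfold totalCycles cycleCount
  symm
  apply Multiset.sum_count_eq_card _ |>.symm
  intro m hm
  have h2 := Multiset.le_sum_of_mem hm
  rw [σ.partition.parts_sum, Fintype.card_fin] at h2
  rw [Finset.mem_Icc]
  exact ⟨σ.partition.parts_pos hm, h2⟩

/-- The weighted generating sum over `S_n` in terms of `cycleSum`. -/
theorem sum_weight_mul_pow (θ : ℕ → ℝ) (A : Finset ℕ) (w : ℂ) (n : ℕ) :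
    ∑ σ : Equiv.Perm (Fin n), (weight θ A σ : ℂ) * w ^ totalCycles σ =
      (n.factorial : ℂ) * cycleSum (fun m => if m ∈ A then w * θ m else 0) n := by
  rw [← sum_perm_prod_eq]
  refine Finset.sum_congr rfl fun σ _ => ?_
  rw [totalCycles_eq_card, weight]
  have : ∀ s : Multiset ℕ, (((s.map (fun m => if m ∈ A then θ m else 0)).prod : ℝ) : ℂ) *
      w ^ Multiset.card s = (s.map (fun m => if m ∈ A then w * (θ m : ℂ) else 0)).prod := by
    intro s
    induction s using Multiset.induction_on with
    | empty => simp
    | cons m s ih =>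
      simp only [Multiset.map_cons, Multiset.prod_cons, Multiset.card_cons]
      rw [← ih]
      split_ifs <;> push_cast <;> ring
  exact this _

theorem ofReal_h (θ : ℕ → ℝ) (A : Finset ℕ) (n : ℕ) :
    (h θ A n : ℂ) = cycleSum (fun m => if m ∈ A then (θ m : ℂ) else 0) n := by
  have h1 := sum_weight_mul_pow θ A 1 n
  simp only [one_pow, mul_one, one_mul] at h1
  have h0 : (n.factorial : ℂ) ≠ 0 := by exact_mod_cast Nat.factorial_ne_zero _
  rw [h]
  push_cast
  rw [h1]
  field_simp

theorem expect_exp_eq (θ : ℕ → ℝ) (A : Finset ℕ) (n : ℕ) (z : ℂ) :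
    expect θ A (fun σ : Equiv.Perm (Fin n) => Complex.exp (z * (totalCycles σ : ℂ))) =
      cycleSum (fun m => if m ∈ A then Complex.exp z * θ m else 0) n / (h θ A n : ℂ) := by
  have h0 : (n.factorial : ℂ) ≠ 0 := by exact_mod_cast Nat.factorial_ne_zero _
  have h1 := sum_weight_mul_pow θ A (Complex.exp z) n
  rw [eq_comm, mul_comm, ← eq_div_iff h0] at h1
  rw [h1, expect, Finset.sum_div, Finset.sum_div]
  refine Finset.sum_congr rfl fun σ _ => ?_
  rw [prob, mul_comm z, Complex.exp_nat_mul]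
  push_cast
  rw [one_div, mul_inv]
  ring

/-! ### Taylor coefficients at the origin -/

/-- The `n`-th Taylor coefficient of `f` at `0`. -/
noncomputable def taylorCoeff (f : ℂ → ℂ) (n : ℕ) : ℂ := iteratedDeriv n f 0 / (n.factorial : ℂ)

theorem taylorCoeff_congr {f g : ℂ → ℂ} (hfg : f =ᶠ[𝓝 0] g) (n : ℕ) :
    taylorCoeff f n = taylorCoeff g n := by
  rw [taylorCoeff, taylorCoeff, hfg.iteratedDeriv_eq]

theorem hasFPowerSeriesAt_of_hasSum {f : ℂ → ℂ} {e : ℕ → ℂ}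
    (hf : ∀ᶠ t in 𝓝 (0 : ℂ), HasSum (fun m : ℕ => e m * t ^ m) (f t)) :
    HasFPowerSeriesAt f (FormalMultilinearSeries.ofScalars ℂ e) 0 := by
  rw [hasFPowerSeriesAt_iff]
  filter_upwards [hf] with t ht
  simpa [mul_comm] using ht

theorem taylorCoeff_of_hasSum {f : ℂ → ℂ} {e : ℕ → ℂ}
    (hf : ∀ᶠ t in 𝓝 (0 : ℂ), HasSum (fun m : ℕ => e m * t ^ m) (f t)) (n : ℕ) :
    taylorCoeff f n = e n := by
  obtain ⟨r, hr⟩ := hasFPowerSeriesAt_of_hasSum hf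
  have h := hr.factorial_smul (1 : ℂ) n
  have h0 : (n.factorial : ℂ) ≠ 0 := by exact_mod_cast Nat.factorial_ne_zero _
  rw [taylorCoeff, iteratedDeriv_eq_iteratedFDeriv, ← h]
  simp
  field_simp

theorem taylorCoeff_mul {f g : ℂ → ℂ} (hf : AnalyticAt ℂ f 0) (hg : AnalyticAt ℂ g 0) (n : ℕ) :
    taylorCoeff (f * g) n =
      ∑ i ∈ Finset.range (n + 1), taylorCoeff f i * taylorCoeff g (n - i) := by
  rw [taylorCoeff, iteratedDeriv_mul hf.contDiffAt hg.contDiffAt, Finset.sum_div]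
  refine Finset.sum_congr rfl fun i hi => ?_
  have hi' : i ≤ n := Nat.lt_succ_iff.1 (Finset.mem_range.1 hi)
  have h0 (n : ℕ) : (n.factorial : ℂ) ≠ 0 := by exact_mod_cast Nat.factorial_ne_zero _
  rw [taylorCoeff, taylorCoeff, Nat.cast_choose ℂ hi']
  have := h0 n
  have := h0 i
  have := h0 (n - i)
  field_simp

theorem taylorCoeff_deriv (f : ℂ → ℂ) (n : ℕ) :
    taylorCoeff (deriv f) n = ((n + 1 : ℕ) : ℂ) * taylorCoeff f (n + 1) := by
  have h0 : (n.factorial : ℂ) ≠ 0 := by exact_mod_cast Nat.factorial_ne_zero _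
  have h1 : ((n + 1 : ℕ) : ℂ) ≠ 0 := by exact_mod_cast n.succ_ne_zero
  rw [taylorCoeff, taylorCoeff, iteratedDeriv_succ', Nat.factorial_succ, Nat.cast_mul]
  field_simp

theorem taylorCoeff_zero (f : ℂ → ℂ) : taylorCoeff f 0 = f 0 := by
  simp [taylorCoeff]

theorem taylorCoeff_sub {f g : ℂ → ℂ} (hf : AnalyticAt ℂ f 0) (hg : AnalyticAt ℂ g 0) (n : ℕ) :
    taylorCoeff (f - g) n = taylorCoeff f n - taylorCoeff g n := by
  rw [taylorCoeff, iteratedDeriv_sub hf.contDiffAt hg.contDiffAt, sub_div, taylorCoeff, taylorCoeff]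

theorem taylorCoeff_const_mul (c : ℂ) (f : ℂ → ℂ) (n : ℕ) :
    taylorCoeff (fun t => c * f t) n = c * taylorCoeff f n := by
  rw [taylorCoeff, iteratedDeriv_const_mul_field, taylorCoeff, mul_div_assoc]

/-- The Taylor coefficients of `exp ∘ φ` satisfy a linear recurrence. -/
theorem taylorCoeff_exp_recurrence {φ : ℂ → ℂ} (hφ : AnalyticAt ℂ φ 0) {n : ℕ} (hn : 1 ≤ n) :
    (n : ℂ) * taylorCoeff (fun t => Complex.exp (φ t)) n =
      ∑ m ∈ Finset.Icc 1 n,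
        ((m : ℂ) * taylorCoeff φ m) * taylorCoeff (fun t => Complex.exp (φ t)) (n - m) := by
  obtain ⟨n, rfl⟩ : ∃ k, n = k + 1 := ⟨n - 1, by omega⟩
  -- The recurrence is the coefficient form of `(e^φ)' = φ' e^φ`.
  have hd : deriv (fun t => Complex.exp (φ t)) =ᶠ[𝓝 0]
      deriv φ * (fun t => Complex.exp (φ t)) := by
    filter_upwards [hφ.eventually_analyticAt] with t ht
    rw [Pi.mul_apply, mul_comm]
    exact ht.differentiableAt.hasDerivAt.cexp.deriv
  rw [← taylorCoeff_deriv, taylorCoeff_congr hd, taylorCoeff_mul hφ.deriv hφ.cexp',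
    Finset.range_eq_Ico, Finset.sum_Ico_eq_sum_range, ← Finset.Ico_add_one_right_eq_Icc,
    Finset.sum_Ico_eq_sum_range]
  refine Finset.sum_congr (by simp) fun i _ => ?_
  rw [taylorCoeff_deriv, zero_add, add_comm 1 i, Nat.add_sub_add_right]

/-- Cauchy's formula for a Taylor coefficient, in logarithmic coordinates and in terms of a
primitive. -/
theorem taylorCoeff_eq_primitive {f : ℂ → ℂ} (hf : DifferentiableOn ℂ f (Metric.ball 0 1))
    (n : ℕ) {s : ℝ} (hs : 0 < s) {P : ℂ → ℂ}
    (hP : ∀ y ∈ Set.Icc 0 (2 * Real.pi), HasDerivAt P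
      (f (Complex.exp (-s + y * Complex.I)) * Complex.exp (-(n * (-s + y * Complex.I))))
      (-s + y * Complex.I)) :
    taylorCoeff f n =
      (P (-s + (2 * Real.pi : ℝ) * Complex.I) - P (-s)) / (2 * Real.pi * Complex.I) := by
  have hR : 0 < Real.exp (-s) := Real.exp_pos _
  have hR1 : Real.exp (-s) < 1 := by simpa using hs
  have hball : DiffContOnCl ℂ f (Metric.ball 0 (Real.exp (-s))) :=
    (hf.mono (Metric.closure_ball_subset_closedBall.trans
      (Metric.closedBall_subset_ball hR1))).diffContOnCl
  have hc := hball.circleIntegral_one_div_sub_center_pow_smul hR n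
  have hcm : ∀ y : ℝ, circleMap 0 (Real.exp (-s)) y = Complex.exp (-s + y * Complex.I) := by
    intro y
    rw [circleMap, zero_add, Complex.exp_add]
    push_cast
    rfl
  set F : ℝ → ℂ := fun y => f (Complex.exp (-s + y * Complex.I)) *
    Complex.exp (-(n * (-s + y * Complex.I))) * Complex.I with hF
  -- With `z = e^u` one has `dz / z^(n+1) = e^{-nu} du`, so the circle becomes a vertical segment of
  -- length `2π`.
  have hInt : (∮ z in C(0, Real.exp (-s)), (1 / (z - 0) ^ (n + 1)) • f z) =
      ∫ y in (0 : ℝ)..(2 * Real.pi), F y := by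
    rw [circleIntegral]
    refine intervalIntegral.integral_congr fun y _ => ?_
    simp only [deriv_circleMap, hcm, sub_zero, smul_eq_mul, hF]
    rw [Complex.exp_neg, Complex.exp_nat_mul, pow_succ]
    have := Complex.exp_ne_zero (-s + y * Complex.I)
    field_simp
  have hder : ∀ y ∈ Set.uIcc 0 (2 * Real.pi),
      HasDerivAt (fun y : ℝ => P (-s + y * Complex.I)) (F y) y := by
    intro y hy
    rw [Set.uIcc_of_le (by positivity)] at hy
    have h1 : HasDerivAt (fun y : ℝ => (-s + y * Complex.I : ℂ)) Complex.I y := by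
      simpa using ((Complex.ofRealCLM.hasDerivAt (x := y)).mul_const Complex.I).const_add (-s : ℂ)
    exact (hP y hy).comp y h1
  have hcont : ContinuousOn F (Set.uIcc 0 (2 * Real.pi)) := by
    have : Continuous fun y : ℝ => f (Complex.exp (-s + y * Complex.I)) := by
      rw [← continuousOn_univ]
      refine hf.continuousOn.comp (Continuous.continuousOn (by fun_prop)) fun y _ => ?_
      simpa [Complex.norm_exp] using hs
    exact ((this.mul (by fun_prop)).mul continuous_const).continuousOn
  have hFTC := intervalIntegral.integral_eq_sub_of_hasDerivAt hder hcont.intervalIntegrable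
  rw [hInt, hFTC] at hc
  have h0 : (n.factorial : ℂ) ≠ 0 := by exact_mod_cast Nat.factorial_ne_zero _
  have hpi : (Real.pi : ℂ) ≠ 0 := by exact_mod_cast Real.pi_ne_zero
  have hz : P (-s + (0 : ℝ) * Complex.I) = P (-s) := by simp
  rw [hz, smul_eq_mul] at hc
  rw [hc, taylorCoeff]
  have := Complex.I_ne_zero
  field_simp

/-! ### The rescaled domain and the remainder at the singularity -/

/-- The disc of radius `ρ` with a closed sector at the point `1` removed. -/
def slitDisc (ρ κ : ℝ) : Set ℂ := {z | ‖z‖ < ρ ∧ (z - 1).re < κ * ‖z - 1‖}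

theorem ne_one_of_mem_slitDisc {ρ κ : ℝ} {z : ℂ} (hz : z ∈ slitDisc ρ κ) : z ≠ 1 := by
  rintro rfl
  simpa using hz.2

theorem one_sub_mem_slitPlane {ρ κ : ℝ} (hκ : κ ≤ 1) {z : ℂ} (hz : z ∈ slitDisc ρ κ) :
    1 - z ∈ Complex.slitPlane := by
  rw [Complex.mem_slitPlane_iff]
  by_contra! hcon
  obtain ⟨h1, h2⟩ := hcon
  have him : (z - 1).im = 0 := by
    simp only [Complex.sub_im, Complex.one_im] at h2 ⊢; linarith
  have hre : 0 ≤ (z - 1).re := by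
    simp only [Complex.sub_re, Complex.one_re] at h1 ⊢; linarith
  have hn : ‖z - 1‖ = (z - 1).re := by
    have : z - 1 = ((z - 1).re : ℂ) := Complex.ext (by simp) (by simpa using him)
    rw [this, Complex.norm_real, Real.norm_eq_abs, Complex.ofReal_re, abs_of_nonneg hre]
  have h3 := hz.2
  rw [hn] at h3
  nlinarith

theorem mem_slitDisc_of_norm_lt_one {ρ κ : ℝ} (hρ : 1 ≤ ρ) (hκ : 0 ≤ κ) {z : ℂ} (hz : ‖z‖ < 1) :
    z ∈ slitDisc ρ κ := by
  refine ⟨hz.trans_le hρ, ?_⟩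
  have h1 : (z - 1).re < 0 := by
    have := (Complex.re_le_norm z).trans_lt hz
    simp only [Complex.sub_re, Complex.one_re]; linarith
  exact h1.trans_le (by positivity)

/-- Cosine decreases on `[0, π]`, so `cos φ` encodes the aperture of the sector; this is why
`slitDisc` can be defined without the argument function. -/
theorem lt_abs_arg_of_re_lt {φ : ℝ} (hφ : φ ≤ Real.pi) {z : ℂ}
    (hz : z.re < Real.cos φ * ‖z‖) : φ < |Complex.arg z| := by
  by_contra! hcon
  have h1 : Real.cos φ ≤ Real.cos (Complex.arg z) := by
    rw [← Real.cos_abs (Complex.arg z)]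
    exact Real.cos_le_cos_of_nonneg_of_le_pi (abs_nonneg _) hφ hcon
  have h2 := Complex.norm_mul_cos_arg z
  nlinarith [norm_nonneg z]

theorem mul_mem_Delta0 {r R φ : ℝ} (hr : 0 < r) (hφ : φ ≤ Real.pi) {z : ℂ}
    (hz : z ∈ slitDisc (R / r) (Real.cos φ)) : (r : ℂ) * z ∈ Delta0 r R φ := by
  refine ⟨?_, ?_, ?_⟩
  · rw [norm_mul, Complex.norm_real, Real.norm_of_nonneg hr.le, mul_comm]
    exact (lt_div_iff₀ hr).1 hz.1
  · intro h
    have hr' : (r : ℂ) ≠ 0 := by exact_mod_cast hr.ne'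
    exact ne_one_of_mem_slitDisc hz (mul_left_cancel₀ hr' (by rw [h, mul_one]))
  · rw [show (r : ℂ) * z - r = (r : ℂ) * (z - 1) by ring, Complex.arg_real_mul _ hr]
    exact lt_abs_arg_of_re_lt hφ hz.2

/-- After rescaling the singularity to `1`, a function in the class `ℱ(r, ϑ, K)` is the sum of a
logarithm, a constant and a remainder of order `z - 1`. -/
theorem GenFunMem.exists_remainder {θ : ℕ → ℝ} {r ϑ K : ℝ} (hr : 0 < r)
    (hg : GenFunMem θ r ϑ K) :
    ∃ (ρ κ M : ℝ) (q : ℂ → ℂ), 1 < ρ ∧ 0 < κ ∧ κ < 1 ∧ 0 ≤ M ∧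
      DifferentiableOn ℂ q (slitDisc ρ κ) ∧ (∀ z ∈ slitDisc ρ κ, ‖q z‖ ≤ M * ‖z - 1‖) ∧
      ∀ z : ℂ, ‖z‖ < 1 → HasSum (fun m : ℕ => ((θ m * r ^ m / m : ℝ) : ℂ) * z ^ m)
        ((ϑ : ℂ) * -Complex.log (1 - z) + K + q z) := by
  obtain ⟨g, ⟨R, φ, hrR, hφ0, hφ, hgd, hO⟩, hsum⟩ := hg
  have hφpi : φ ≤ Real.pi := by linarith [Real.pi_pos]
  have hr' : (r : ℂ) ≠ 0 := by exact_mod_cast hr.ne'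
  set κ₀ := Real.cos φ with hκ₀
  have hκ0 : 0 < κ₀ := Real.cos_pos_of_mem_Ioo ⟨by linarith, hφ⟩
  have hκ1 : κ₀ ≤ 1 := Real.cos_le_one φ
  have hRr : 1 < R / r := by rwa [lt_div_iff₀ hr, one_mul]
  set q : ℂ → ℂ := fun z => g (r * z) + ϑ * Complex.log (1 - z) - K with hq
  have hqd : DifferentiableOn ℂ q (slitDisc (R / r) κ₀) := by
    have h1 : DifferentiableOn ℂ (fun z : ℂ => g (r * z)) (slitDisc (R / r) κ₀) :=
      hgd.comp (f := fun z : ℂ => (r : ℂ) * z) (by fun_prop)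
        fun z hz => mul_mem_Delta0 hr hφpi hz
    have h2 : DifferentiableOn ℂ (fun z : ℂ => Complex.log (1 - z)) (slitDisc (R / r) κ₀) :=
      DifferentiableOn.clog (by fun_prop) fun z hz => one_sub_mem_slitPlane hκ1 hz
    exact (h1.add (h2.const_mul _)).sub_const _
  obtain ⟨C, hC0, hC⟩ := hO.exists_pos
  rw [isBigOWith_iff, eventually_nhdsWithin_iff, Metric.eventually_nhds_iff] at hC
  obtain ⟨ε, hε, hC⟩ := hC
  have hnear : ∀ z ∈ slitDisc (R / r) κ₀, ‖z - 1‖ < ε / r → ‖q z‖ ≤ C * r * ‖z - 1‖ := by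
    intro z hz hzε
    have h1 : ‖(r : ℂ) * z - r‖ = r * ‖z - 1‖ := by
      rw [show (r : ℂ) * z - r = (r : ℂ) * (z - 1) by ring, norm_mul, Complex.norm_real,
        Real.norm_of_nonneg hr.le]
    have h2 := hC (y := (r : ℂ) * z)
      (by rw [dist_eq_norm, h1, mul_comm]; exact (lt_div_iff₀ hr).1 hzε)
      (mul_mem_Delta0 hr hφpi hz)
    have h3 : g (r * z) - ((ϑ : ℂ) * Complex.log (1 / (1 - r * z / (r : ℂ))) + (K : ℂ)) = q z := by
      rw [mul_div_cancel_left₀ _ hr', one_div, Complex.log_inv _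
        (Complex.slitPlane_arg_ne_pi (one_sub_mem_slitPlane hκ1 hz)), hq]
      ring
    rw [h3, h1] at h2
    linarith
  set ρ := (1 + R / r) / 2 with hρ
  have hρ1 : 1 < ρ := by rw [hρ]; linarith
  have hρR : ρ < R / r := by rw [hρ]; linarith
  -- Radius and aperture are both shrunk, so that the part of the smaller closed region away from
  -- `1` is compact inside the domain of `q`.
  set T : Set ℂ := {z | ‖z‖ ≤ ρ ∧ (z - 1).re ≤ κ₀ / 2 * ‖z - 1‖ ∧ ε / r ≤ ‖z - 1‖} with hT
  have hTc : IsCompact T := by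
    have hn : Continuous fun z : ℂ => ‖z - 1‖ := by fun_prop
    have hre : Continuous fun z : ℂ => (z - 1).re := by fun_prop
    have hcl : IsClosed T :=
      (isClosed_le continuous_norm continuous_const).inter
        ((isClosed_le hre (hn.const_mul _)).inter (isClosed_le continuous_const hn))
    refine (isCompact_closedBall (0 : ℂ) ρ).of_isClosed_subset hcl fun z hz => ?_
    simpa using hz.1
  have hTsub : T ⊆ slitDisc (R / r) κ₀ := by
    intro z hz
    refine ⟨hz.1.trans_lt hρR, hz.2.1.trans_lt ?_⟩
    have : 0 < ‖z - 1‖ := (div_pos hε hr).trans_le hz.2.2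
    nlinarith
  obtain ⟨C', hC'⟩ := hTc.exists_bound_of_continuousOn (hqd.continuousOn.mono hTsub)
  have hsub : slitDisc ρ (κ₀ / 2) ⊆ slitDisc (R / r) κ₀ := by
    intro z hz
    refine ⟨hz.1.trans hρR, hz.2.trans_le ?_⟩
    nlinarith [norm_nonneg (z - 1)]
  -- The first summand of the constant serves near `1`; on `T` one has `‖z - 1‖ ≥ ε / r`, which
  -- turns the bound `C'` into a multiple of `‖z - 1‖`.
  refine ⟨ρ, κ₀ / 2, C * r + |C'| * (r / ε), q, hρ1, by linarith, by linarith, by positivity,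
    hqd.mono hsub, ?_, ?_⟩
  · intro z hz
    rw [add_mul]
    rcases lt_or_ge ‖z - 1‖ (ε / r) with h | h
    · refine (hnear z (hsub hz) h).trans (le_add_of_nonneg_right (by positivity))
    · have h1 : ‖q z‖ ≤ |C'| := (hC' z ⟨hz.1.le, hz.2.le, h⟩).trans (le_abs_self _)
      have h2 : 1 ≤ r / ε * ‖z - 1‖ := by
        rw [div_le_iff₀ hr] at h
        rw [div_mul_eq_mul_div, le_div_iff₀ hε]
        linarith
      have h3 : |C'| ≤ |C'| * (r / ε) * ‖z - 1‖ := by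
        rw [mul_assoc]
        exact le_mul_of_one_le_right (abs_nonneg _) h2
      exact (h1.trans h3).trans (le_add_of_nonneg_left (by positivity))
  · intro z hz
    -- Convergence is given only near `0`; holomorphy of `g` on the disc of radius `r` extends the
    -- expansion to that disc, with the same coefficients.
    have hball : DifferentiableOn ℂ g (Metric.ball 0 r) := by
      refine hgd.mono fun t ht => ?_
      rw [mem_ball_zero_iff] at ht
      have h1 : t = (r : ℂ) * (t / r) := by field_simp
      rw [h1]
      refine mul_mem_Delta0 hr hφpi (mem_slitDisc_of_norm_lt_one hRr.le hκ0.le ?_)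
      rwa [norm_div, Complex.norm_real, Real.norm_of_nonneg hr.le, div_lt_one hr]
    have hrz : (r : ℂ) * z ∈ Metric.ball 0 r := by
      rw [mem_ball_zero_iff, norm_mul, Complex.norm_real, Real.norm_of_nonneg hr.le]
      nlinarith
    have h1 := Complex.hasSum_taylorSeries_on_ball hball hrz
    have h2 : (ϑ : ℂ) * -Complex.log (1 - z) + K + q z = g (r * z) := by
      rw [hq]; ring
    rw [h2]
    refine h1.congr_fun fun m => ?_
    have h3 := taylorCoeff_of_hasSum hsum m
    rw [taylorCoeff] at h3
    simp only [sub_zero, smul_eq_mul]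
    push_cast
    rw [mul_div_right_comm, ← h3]
    ring

/-! ### Partial sums of the coefficients -/

section CoefficientBounds

variable {c : ℕ → ℝ} {ϑ K M : ℝ} {Q : ℝ → ℝ}

theorem half_le_one_sub_pow {d m : ℕ} (hd : 1 ≤ d) (hm : m ≤ d) :
    1 / 2 ≤ (1 - 1 / (2 * (d : ℝ))) ^ m := by
  have hd' : (1 : ℝ) ≤ d := by exact_mod_cast hd
  have hm' : (m : ℝ) ≤ d := by exact_mod_cast hm
  have h1 : 1 / (2 * (d : ℝ)) ≤ 1 := by
    rw [div_le_one (by positivity)]; linarith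
  have h := one_add_mul_le_pow (a := -(1 / (2 * (d : ℝ)))) (by linarith) m
  have h2 : (m : ℝ) * (1 / (2 * (d : ℝ))) ≤ 1 / 2 := by
    rw [mul_one_div, div_le_div_iff₀ (by positivity) (by positivity)]; linarith
  rw [sub_eq_add_neg]
  linarith

/-- At `t = 1 - 1/(2d)` every `t^m` with `m ≤ d` is at least `1/2`, so by positivity the partial sum
is at most twice the value of the series, which is of order `log d`. -/
theorem sum_coeff_div_le (hc : ∀ m, 1 ≤ m → 0 ≤ c m) (hϑ : 0 ≤ ϑ) (hM : 0 ≤ M)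
    (hQ : ∀ s, 0 < s → s < 1 → |Q s| ≤ M * s ∧
      HasSum (fun m : ℕ => c m / m * (1 - s) ^ m) (-ϑ * Real.log s + K + Q s)) :
    ∃ C, 0 ≤ C ∧ ∀ d : ℕ, 1 ≤ d →
      ∑ m ∈ Finset.Icc 1 d, c m / m ≤ C * (1 + Real.log d) := by
  have hl2 : 0 ≤ Real.log 2 := Real.log_nonneg (by norm_num)
  refine ⟨2 * (ϑ * Real.log 2 + ϑ + |K| + M), by positivity, fun d hd => ?_⟩
  have hd' : (1 : ℝ) ≤ d := by exact_mod_cast hd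
  have hld : 0 ≤ Real.log d := Real.log_nonneg hd'
  set s : ℝ := 1 / (2 * (d : ℝ)) with hs
  have hs0 : 0 < s := by positivity
  have hs1 : s < 1 := by rw [hs, div_lt_one (by positivity)]; linarith
  obtain ⟨hQs, hsum⟩ := hQ s hs0 hs1
  -- No sign is known for `c 0`, but division by zero makes the term of index `0` vanish.
  have hnn : ∀ m : ℕ, 0 ≤ c m / m := by
    intro m
    rcases Nat.eq_zero_or_pos m with rfl | hm
    · simp
    · exact div_nonneg (hc m hm) (Nat.cast_nonneg _)
  have h1 := sum_le_hasSum (Finset.Icc 1 d)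
    (fun m _ => mul_nonneg (hnn m) (pow_nonneg (by linarith) m)) hsum
  have h2 : ∑ m ∈ Finset.Icc 1 d, c m / m * (1 / 2) ≤
      ∑ m ∈ Finset.Icc 1 d, c m / m * (1 - s) ^ m := by
    refine Finset.sum_le_sum fun m hm => mul_le_mul_of_nonneg_left ?_ (hnn m)
    exact half_le_one_sub_pow hd (Finset.mem_Icc.1 hm).2
  rw [← Finset.sum_mul] at h2
  have hlog : Real.log s = -(Real.log 2 + Real.log d) := by
    rw [hs, one_div, Real.log_inv, Real.log_mul (by norm_num) (by positivity)]
  rw [hlog] at h1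
  have h3 := le_abs_self K
  have h4 : Q s ≤ M := (le_abs_self _).trans (hQs.trans (by nlinarith))
  have h5 : 0 ≤ (ϑ * Real.log 2 + |K| + M) * Real.log d := by positivity
  nlinarith

/-- Bernoulli's inequality for the ratio `(1 - s/2) / (1 - s) ≥ 1 + s/2`. -/
theorem mul_quarter_le_pow_sub_pow {s : ℝ} (hs0 : 0 < s) (hs1 : s < 1) {m : ℕ}
    (hm : 1 / 2 ≤ (1 - s) ^ m) : m * s / 4 ≤ (1 - s / 2) ^ m - (1 - s) ^ m := by
  have hy : 0 < 1 - s := by linarith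
  have h := one_add_mul_le_pow (a := s / 2 / (1 - s)) (by
    have : 0 ≤ s / 2 / (1 - s) := by positivity
    linarith) m
  have h2 : 1 + s / 2 / (1 - s) = (1 - s / 2) / (1 - s) := by field_simp; ring
  rw [h2, div_pow, le_div_iff₀ (by positivity)] at h
  have h3 : s / 2 ≤ s / 2 / (1 - s) := by
    rw [le_div_iff₀ hy]; nlinarith
  have h4 : (m : ℝ) * (s / 2) * (1 / 2) ≤ m * (s / 2 / (1 - s)) * (1 - s) ^ m := by
    gcongr
  linarith

/-- The values of the series at `1 - s` and `1 - s/2` differ by a bounded amount: `K` cancels and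
the logarithms differ by `log 2`. For `s = 1/(2d)` each index `m ≤ d` contributes at least `c m * (s
/ 4)` to this difference, and `s / 4 = 1/(8d)` gives the factor `8`. -/
theorem sum_coeff_le (hc : ∀ m, 1 ≤ m → 0 ≤ c m) (hϑ : 0 ≤ ϑ) (hM : 0 ≤ M)
    (hQ : ∀ s, 0 < s → s < 1 → |Q s| ≤ M * s ∧
      HasSum (fun m : ℕ => c m / m * (1 - s) ^ m) (-ϑ * Real.log s + K + Q s)) :
    ∃ C, 0 ≤ C ∧ ∀ d : ℕ, 1 ≤ d → ∑ m ∈ Finset.Icc 1 d, c m ≤ C * d := by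
  have hl2 : 0 ≤ Real.log 2 := Real.log_nonneg (by norm_num)
  refine ⟨8 * (ϑ * Real.log 2 + 2 * M), by positivity, fun d hd => ?_⟩
  have hd' : (1 : ℝ) ≤ d := by exact_mod_cast hd
  set s : ℝ := 1 / (2 * (d : ℝ)) with hs
  have hs0 : 0 < s := by positivity
  have hs1 : s < 1 := by rw [hs, div_lt_one (by positivity)]; linarith
  obtain ⟨hQs, hsum⟩ := hQ s hs0 hs1
  obtain ⟨hQs', hsum'⟩ := hQ (s / 2) (by linarith) (by linarith)
  have hnn : ∀ m : ℕ, 0 ≤ c m / m := by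
    intro m
    rcases Nat.eq_zero_or_pos m with rfl | hm
    · simp
    · exact div_nonneg (hc m hm) (Nat.cast_nonneg _)
  have hdiff := hsum'.sub hsum
  have h1 := sum_le_hasSum (Finset.Icc 1 d) (fun m _ => by
    rw [← mul_sub]
    refine mul_nonneg (hnn m) (sub_nonneg.2 ?_)
    exact pow_le_pow_left₀ (by linarith) (by linarith) m) hdiff
  have h2 : ∑ m ∈ Finset.Icc 1 d, c m * (s / 4) ≤
      ∑ m ∈ Finset.Icc 1 d, (c m / m * (1 - s / 2) ^ m - c m / m * (1 - s) ^ m) := by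
    refine Finset.sum_le_sum fun m hm => ?_
    rw [Finset.mem_Icc] at hm
    have hm0 : (0 : ℝ) < m := by exact_mod_cast hm.1
    rw [← mul_sub]
    have h3 := mul_quarter_le_pow_sub_pow hs0 hs1 (half_le_one_sub_pow hd hm.2)
    calc c m * (s / 4) = c m / m * (m * s / 4) := by field_simp
      _ ≤ _ := mul_le_mul_of_nonneg_left h3 (hnn m)
  rw [← Finset.sum_mul] at h2
  have hlog : Real.log (s / 2) = Real.log s - Real.log 2 := Real.log_div hs0.ne' (by norm_num)
  rw [hlog] at h1
  have h3 := (le_abs_self _).trans hQs'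
  have h4 := (neg_abs_le _).trans' (neg_le_neg hQs)
  have h5 : (∑ m ∈ Finset.Icc 1 d, c m) * (s / 4) ≤ ϑ * Real.log 2 + 2 * M := by nlinarith
  rw [← le_div_iff₀ (by positivity)] at h5
  refine h5.trans (le_of_eq ?_)
  rw [hs]
  field_simp
  ring

end CoefficientBounds

/-! ### Uniform asymptotics for the coefficients of a power of `1 - t` -/

theorem norm_exp_sub_one_le_mul_exp (z : ℂ) : ‖Complex.exp z - 1‖ ≤ ‖z‖ * Real.exp ‖z‖ := by
  simpa using Complex.norm_exp_sub_sum_le_norm_mul_exp z 1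

theorem norm_exp_sub_one_sub_le (z : ℂ) :
    ‖Complex.exp z - 1 - z‖ ≤ ‖z‖ ^ 2 * Real.exp ‖z‖ := by
  have := Complex.norm_exp_sub_sum_le_norm_mul_exp z 2
  simpa [Finset.sum_range_succ, sub_sub] using this

/-- The Taylor coefficients of `(1 - t) ^ (-a)`. -/
noncomputable def powCoeff (a : ℂ) (n : ℕ) : ℂ :=
  taylorCoeff (fun t => Complex.exp (a * -Complex.log (1 - t))) n

theorem hasSum_mul_neg_log (a : ℂ) {t : ℂ} (ht : ‖t‖ < 1) :
    HasSum (fun m : ℕ => a / m * t ^ m) (a * -Complex.log (1 - t)) := by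
  refine ((Complex.hasSum_taylorSeries_neg_log ht).mul_left a).congr_fun fun m => ?_
  ring

theorem eventually_norm_lt_one : ∀ᶠ t in 𝓝 (0 : ℂ), ‖t‖ < 1 := by
  filter_upwards [Metric.ball_mem_nhds (0 : ℂ) one_pos] with t ht
  simpa using ht

theorem analyticAt_mul_neg_log (a : ℂ) :
    AnalyticAt ℂ (fun t : ℂ => a * -Complex.log (1 - t)) 0 :=
  (hasFPowerSeriesAt_of_hasSum (eventually_norm_lt_one.mono
    fun _ ht => hasSum_mul_neg_log a ht)).analyticAt

theorem powCoeff_zero (a : ℂ) : powCoeff a 0 = 1 := by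
  rw [powCoeff, taylorCoeff_zero]; simp

theorem mul_powCoeff (a : ℂ) (n : ℕ) :
    (n : ℂ) * powCoeff a n = a * ∑ j ∈ Finset.range n, powCoeff a j := by
  rcases Nat.eq_zero_or_pos n with rfl | hn
  · simp
  have h1 : (n : ℂ) * powCoeff a n = ∑ m ∈ Finset.Icc 1 n,
      ((m : ℂ) * taylorCoeff (fun t => a * -Complex.log (1 - t)) m) * powCoeff a (n - m) :=
    taylorCoeff_exp_recurrence (analyticAt_mul_neg_log a) hn
  rw [h1, Finset.mul_sum, ← Finset.sum_range_reflect, ← Finset.Ico_add_one_right_eq_Icc,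
    Finset.sum_Ico_eq_sum_range]
  refine Finset.sum_congr (by simp) fun i hi => ?_
  rw [taylorCoeff_of_hasSum (eventually_norm_lt_one.mono fun _ ht => hasSum_mul_neg_log a ht),
    show n - (1 + i) = n - 1 - i by omega]
  have : ((1 + i : ℕ) : ℂ) ≠ 0 := by exact_mod_cast (by omega : 1 + i ≠ 0)
  field_simp

theorem succ_mul_powCoeff_succ (a : ℂ) (n : ℕ) :
    ((n : ℂ) + 1) * powCoeff a (n + 1) = (n + a) * powCoeff a n := by
  have h1 := mul_powCoeff a (n + 1)
  rw [Finset.sum_range_succ, mul_add, ← mul_powCoeff] at h1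
  push_cast at h1
  rw [h1]; ring

theorem powCoeff_eq_prod (a : ℂ) (n : ℕ) :
    powCoeff a n = (∏ j ∈ Finset.range n, (a + j)) / (n.factorial : ℂ) := by
  induction n with
  | zero => simp [powCoeff_zero]
  | succ n ih =>
    have h := succ_mul_powCoeff_succ a n
    have h1 : (n : ℂ) + 1 ≠ 0 := by exact_mod_cast n.succ_ne_zero
    have h0 : (n.factorial : ℂ) ≠ 0 := by exact_mod_cast Nat.factorial_ne_zero _
    rw [Finset.prod_range_succ, Nat.factorial_succ, Nat.cast_mul, Nat.cast_succ]
    rw [ih] at h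
    field_simp at h ⊢
    linear_combination h

/-- The Taylor coefficients of `(1 - t) ^ (-a)` normalized by their order of growth. -/
noncomputable def scaledPowCoeff (a : ℂ) (n : ℕ) : ℂ :=
  powCoeff a n * Complex.exp ((1 - a) * (Real.log n : ℝ))

/-- This links the coefficients to Euler's limit formula for `Γ`, which identifies their limit. -/
theorem inv_GammaSeq (a : ℂ) {n : ℕ} (hn : 1 ≤ n) :
    (Complex.GammaSeq a n)⁻¹ = scaledPowCoeff a n * ((n + a) / n) := by
  have hn0 : (n : ℂ) ≠ 0 := by exact_mod_cast (by omega : n ≠ 0)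
  have h0 : (n.factorial : ℂ) ≠ 0 := by exact_mod_cast Nat.factorial_ne_zero _
  have hlog : ((Real.log n : ℝ) : ℂ) = Complex.log n := by
    rw [Complex.ofReal_log (Nat.cast_nonneg _), Complex.ofReal_natCast]
  rw [Complex.GammaSeq, scaledPowCoeff, powCoeff_eq_prod, hlog, sub_mul, one_mul, Complex.exp_sub,
    Complex.exp_log hn0, Complex.cpow_def_of_ne_zero hn0, Finset.prod_range_succ,
    mul_comm (Complex.log n) a, inv_div]
  have := Complex.exp_ne_zero (a * Complex.log n)
  field_simp
  ring

theorem tendsto_scaledPowCoeff (a : ℂ) :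
    Tendsto (scaledPowCoeff a) atTop (𝓝 (Complex.Gamma a)⁻¹) := by
  -- At a pole `-k` the conventions `Γ(-k) = 0` and `0⁻¹ = 0` give the value of the entire function
  -- `1/Γ`; there the rising product contains a zero factor once `n > k`.
  by_cases hG : Complex.Gamma a = 0
  · obtain ⟨k, rfl⟩ := (Complex.Gamma_eq_zero_iff a).1 hG
    rw [hG, inv_zero]
    refine tendsto_const_nhds.congr' ?_
    filter_upwards [eventually_gt_atTop k] with n hn
    have : ∏ j ∈ Finset.range n, (-(k : ℂ) + j) = 0 :=
      Finset.prod_eq_zero (Finset.mem_range.2 hn) (by ring)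
    rw [scaledPowCoeff, powCoeff_eq_prod, this]
    simp
  · have h1 := (Complex.GammaSeq_tendsto_Gamma a).inv₀ hG
    have h2 : Tendsto (fun n : ℕ => (n : ℂ) / (n + a)) atTop (𝓝 1) :=
      tendsto_natCast_div_add_atTop a
    have h3 := h1.mul h2
    rw [mul_one] at h3
    refine h3.congr' ?_
    have h4 : ∀ᶠ n : ℕ in atTop, ‖(n : ℂ)‖ > ‖a‖ := by
      simp only [Complex.norm_natCast]
      exact tendsto_natCast_atTop_atTop.eventually_gt_atTop _
    filter_upwards [h4, eventually_ge_atTop 1] with n hn hn1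
    have h5 : (n : ℂ) + a ≠ 0 := by
      intro h
      rw [eq_neg_of_add_eq_zero_left h, norm_neg] at hn
      exact lt_irrefl _ hn
    have hn0 : (n : ℂ) ≠ 0 := by exact_mod_cast (by omega : n ≠ 0)
    rw [inv_GammaSeq a hn1]
    field_simp

theorem abs_log_one_add_sub_le {x : ℝ} (hx : 0 ≤ x) : |Real.log (1 + x) - x| ≤ x ^ 2 := by
  have h1 := Real.log_le_sub_one_of_pos (x := 1 + x) (by linarith)
  have h2 := Real.one_sub_inv_le_log_of_pos (x := 1 + x) (by linarith)
  have h3 : 1 - (1 + x)⁻¹ = x - x ^ 2 / (1 + x) := by field_simp; ring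
  have h4 : x ^ 2 / (1 + x) ≤ x ^ 2 := div_le_self (by positivity) (by linarith)
  rw [abs_le]
  constructor <;> nlinarith [sq_nonneg x]

/-- The constant in the bound for the ratio of consecutive normalized coefficients. -/
noncomputable def ratioBound (A : ℝ) : ℝ := A + A ^ 2 + (1 + A) * (A ^ 2 * Real.exp A)

/-- With `x = 1/n` this is the ratio of consecutive normalized coefficients. The first-order terms
`a x` and `-a log(1 + x)` cancel up to `O(x²)`, which makes the product of the ratios converge
uniformly for bounded `a`. -/
theorem norm_one_add_mul_exp_sub_one_le {a : ℂ} {A x : ℝ} (ha : ‖a‖ ≤ A) (hx : 0 ≤ x)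
    (hx1 : x ≤ 1) :
    ‖(1 + a * x) * Complex.exp (-a * (Real.log (1 + x) : ℝ)) - 1‖ ≤ ratioBound A * x ^ 2 := by
  set l := Real.log (1 + x) with hl
  have hA : 0 ≤ A := (norm_nonneg _).trans ha
  have hl0 : 0 ≤ l := Real.log_nonneg (by linarith)
  have hlx : l ≤ x := by
    have := Real.log_le_sub_one_of_pos (x := 1 + x) (by linarith)
    linarith
  set e := Complex.exp (-a * l) - 1 - (-a * l) with he
  have hnorm : ‖-a * (l : ℂ)‖ = ‖a‖ * l := by
    rw [norm_mul, norm_neg, Complex.norm_real, Real.norm_of_nonneg hl0]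
  have hal : ‖a‖ * l ≤ A * x := mul_le_mul ha hlx hl0 hA
  have he1 : ‖e‖ ≤ A ^ 2 * Real.exp A * x ^ 2 := by
    refine (norm_exp_sub_one_sub_le _).trans ?_
    rw [hnorm]
    calc (‖a‖ * l) ^ 2 * Real.exp (‖a‖ * l) ≤ (A * x) ^ 2 * Real.exp A := by
          have : ‖a‖ * l ≤ A := hal.trans (by nlinarith)
          gcongr
      _ = _ := by ring
  have hdec : (1 + a * x) * Complex.exp (-a * l) - 1 =
      -a * ((l - x : ℝ) : ℂ) + -(a ^ 2) * (x * l : ℝ) + (1 + a * x) * e := by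
    rw [he]; push_cast; ring
  have h1 : ‖-a * ((l - x : ℝ) : ℂ)‖ ≤ A * x ^ 2 := by
    rw [norm_mul, norm_neg, Complex.norm_real]
    exact mul_le_mul ha (abs_log_one_add_sub_le hx) (norm_nonneg _) hA
  have h2 : ‖-(a ^ 2) * ((x * l : ℝ) : ℂ)‖ ≤ A ^ 2 * x ^ 2 := by
    rw [norm_mul, norm_neg, Complex.norm_real, norm_pow, Real.norm_of_nonneg (by positivity)]
    have : x * l ≤ x ^ 2 := by nlinarith
    gcongr
  have h3 : ‖(1 + a * x) * e‖ ≤ (1 + A) * (A ^ 2 * Real.exp A * x ^ 2) := by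
    rw [norm_mul]
    refine mul_le_mul ?_ he1 (norm_nonneg _) (by positivity)
    refine (norm_add_le _ _).trans ?_
    rw [norm_one, norm_mul, Complex.norm_real, Real.norm_of_nonneg hx]
    nlinarith [norm_nonneg a]
  rw [hdec]
  refine (norm_add₃_le).trans ?_
  rw [ratioBound]
  linarith

theorem scaledPowCoeff_succ (a : ℂ) {n : ℕ} (hn : 1 ≤ n) :
    scaledPowCoeff a (n + 1) = scaledPowCoeff a n *
      ((1 + a * (1 / n : ℝ)) * Complex.exp (-a * (Real.log (1 + 1 / n) : ℝ))) := by
  have hn0 : (0 : ℝ) < n := by exact_mod_cast hn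
  have hnc : (n : ℂ) ≠ 0 := by exact_mod_cast hn0.ne'
  have h1 : (n : ℂ) + 1 ≠ 0 := by exact_mod_cast n.succ_ne_zero
  have hlog : Real.log ((n + 1 : ℕ) : ℝ) = Real.log n + Real.log (1 + 1 / n) := by
    rw [← Real.log_mul hn0.ne' (by positivity)]
    congr 1
    push_cast
    field_simp
  have hexp : Complex.exp ((Real.log (1 + 1 / n) : ℝ) : ℂ) = ((n : ℂ) + 1) / n := by
    rw [← Complex.ofReal_exp, Real.exp_log (by positivity)]
    push_cast
    field_simp
  have hb : powCoeff a (n + 1) = (n + a) / (n + 1) * powCoeff a n := by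
    have := succ_mul_powCoeff_succ a n
    field_simp
    linear_combination this
  rw [scaledPowCoeff, scaledPowCoeff, hb, hlog, Complex.ofReal_add, mul_add, Complex.exp_add,
    show (1 - a) * ((Real.log (1 + 1 / n) : ℝ) : ℂ) =
      (Real.log (1 + 1 / n) : ℝ) + -a * (Real.log (1 + 1 / n) : ℝ) by ring, Complex.exp_add, hexp]
  push_cast
  field_simp

theorem one_div_sq_le {n : ℕ} (hn : 1 ≤ n) :
    (1 / (n : ℝ)) ^ 2 ≤ 2 * (1 / n - 1 / ((n + 1 : ℕ) : ℝ)) := by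
  have hn1 : (1 : ℝ) ≤ n := by exact_mod_cast hn
  have : 2 * (1 / n - 1 / ((n + 1 : ℕ) : ℝ)) = 2 / (n * (n + 1)) := by
    push_cast; field_simp; ring
  rw [this, one_div, inv_pow, ← one_div, div_le_div_iff₀ (by positivity) (by positivity)]
  nlinarith

/-- The excesses `O(1/k²)` of the ratios are dominated by telescoping differences `2 (1/k -
1/(k+1))`; the exponent records their sum up to `n`. -/
theorem norm_scaledPowCoeff_le {a : ℂ} {A : ℝ} (ha : ‖a‖ ≤ A) {n : ℕ} (hn : 1 ≤ n) :
    ‖scaledPowCoeff a n‖ ≤ A * Real.exp (ratioBound A * (2 - 2 / n)) := by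
  have hA : 0 ≤ A := (norm_nonneg _).trans ha
  have hC : 0 ≤ ratioBound A := by unfold ratioBound; positivity
  induction n, hn using Nat.le_induction with
  | base =>
    have : scaledPowCoeff a 1 = a := by
      simp [scaledPowCoeff, powCoeff_eq_prod]
    rw [this]
    simpa using ha
  | succ n hn ih =>
    have hn1 : (1 : ℝ) ≤ n := by exact_mod_cast hn
    have hx1 : 1 / (n : ℝ) ≤ 1 := by rw [div_le_one (by linarith)]; exact hn1
    have h1 := norm_one_add_mul_exp_sub_one_le ha (x := 1 / n) (by positivity) hx1
    rw [scaledPowCoeff_succ a hn, norm_mul]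
    set X := (1 + a * ((1 / n : ℝ) : ℂ)) * Complex.exp (-a * (Real.log (1 + 1 / n) : ℝ)) with hX
    have h2 : ‖X‖ ≤ 1 + ratioBound A * (1 / n) ^ 2 := by
      have := norm_add_le (X - 1) 1
      rw [sub_add_cancel, norm_one] at this
      linarith
    have h3 : ‖X‖ ≤ Real.exp (ratioBound A * (2 * (1 / n - 1 / ((n + 1 : ℕ) : ℝ)))) := by
      refine h2.trans ?_
      have h4 := mul_le_mul_of_nonneg_left (one_div_sq_le hn) hC
      have h5 := Real.add_one_le_exp (ratioBound A * (2 * (1 / n - 1 / ((n + 1 : ℕ) : ℝ))))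
      linarith
    refine (mul_le_mul ih h3 (norm_nonneg _) (by positivity)).trans (le_of_eq ?_)
    rw [mul_assoc, ← Real.exp_add]
    congr 2
    ring

/-- Uniform asymptotics of the Taylor coefficients of `(1 - t) ^ (-a)`. -/
theorem exists_norm_scaledPowCoeff_sub_le (A : ℝ) :
    ∃ C, 0 ≤ C ∧ ∀ a : ℂ, ‖a‖ ≤ A → ∀ n : ℕ, 1 ≤ n →
      ‖scaledPowCoeff a n - (Complex.Gamma a)⁻¹‖ ≤ C / n := by
  refine ⟨|A| * Real.exp (ratioBound |A| * 2) * ratioBound |A| * 2, ?_, fun a ha n hn => ?_⟩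
  · unfold ratioBound; positivity
  have ha' : ‖a‖ ≤ |A| := ha.trans (le_abs_self A)
  set R := ratioBound |A| with hR
  have hR0 : 0 ≤ R := by rw [hR, ratioBound]; positivity
  set B := |A| * Real.exp (R * 2) with hB
  have hB0 : 0 ≤ B := by positivity
  have hstep : ∀ k : ℕ, 1 ≤ k → ‖scaledPowCoeff a (k + 1) - scaledPowCoeff a k‖ ≤
      B * R * 2 * (1 / k - 1 / ((k + 1 : ℕ) : ℝ)) := by
    intro k hk
    have hk1 : (1 : ℝ) ≤ k := by exact_mod_cast hk
    have hx1 : 1 / (k : ℝ) ≤ 1 := by rw [div_le_one (by linarith)]; exact hk1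
    rw [scaledPowCoeff_succ a hk, ← mul_sub_one, norm_mul]
    have h1 : ‖scaledPowCoeff a k‖ ≤ B := by
      refine (norm_scaledPowCoeff_le ha' hk).trans ?_
      have : (2 : ℝ) - 2 / k ≤ 2 := by
        have : (0 : ℝ) ≤ 2 / k := by positivity
        linarith
      rw [hB]
      gcongr
    refine (mul_le_mul h1 (norm_one_add_mul_exp_sub_one_le ha' (by positivity) hx1)
      (norm_nonneg _) hB0).trans ?_
    have := mul_le_mul_of_nonneg_left (one_div_sq_le hk) (mul_nonneg hB0 hR0)
    linarith
  -- The limit is already known; its rate follows by telescoping from `n` to `m` and letting `m`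
  -- tend to infinity.
  have hsum : ∀ m : ℕ, n ≤ m → ‖scaledPowCoeff a n - scaledPowCoeff a m‖ ≤ B * R * 2 / n := by
    intro m hm
    have h : ‖scaledPowCoeff a n - scaledPowCoeff a m‖ ≤ B * R * 2 * (1 / n - 1 / m) := by
      induction m, hm using Nat.le_induction with
      | base => simp
      | succ m hm ih =>
        have h1 := norm_sub_le_norm_sub_add_norm_sub (scaledPowCoeff a n) (scaledPowCoeff a m)
          (scaledPowCoeff a (m + 1))
        have h2 := hstep m (hn.trans hm)
        rw [norm_sub_rev] at h2
        linarith
    refine h.trans ?_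
    rw [div_eq_mul_one_div (B * R * 2)]
    have : (0 : ℝ) ≤ 1 / m := by positivity
    exact mul_le_mul_of_nonneg_left (by linarith) (by positivity)
  have hlim := ((tendsto_scaledPowCoeff a).const_sub (scaledPowCoeff a n)).norm
  exact le_of_tendsto hlim ((eventually_ge_atTop n).mono hsum)

/-! ### The contour estimate in the logarithmic coordinate -/

/-- A convex domain that contains, in the logarithmic coordinate, the circle of radius less
than `1` together with the part beyond it that avoids sectors at `0` and at `2πi`. -/
def logDomain (δ k : ℝ) : Set ℂ :=
  {u | u.re < δ ∧ k * u.re < u.im ∧ k / 2 * u.re < u.im ∧ k * u.re < 2 * Real.pi - u.im ∧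
    k / 2 * u.re < 2 * Real.pi - u.im}

theorem isOpen_logDomain (δ k : ℝ) : IsOpen (logDomain δ k) := by
  have h1 := Complex.continuous_re
  have h2 := Complex.continuous_im
  have h3 : Continuous fun u : ℂ => 2 * Real.pi - u.im := continuous_const.sub h2
  exact (isOpen_lt h1 continuous_const).inter ((isOpen_lt (h1.const_mul k) h2).inter
    ((isOpen_lt (h1.const_mul _) h2).inter ((isOpen_lt (h1.const_mul k) h3).inter
      (isOpen_lt (h1.const_mul _) h3))))

theorem convex_logDomain (δ k : ℝ) : Convex ℝ (logDomain δ k) := by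
  intro u hu v hv a b ha hb hab
  have aux : ∀ {p q r s : ℝ}, p < r → q < s → a * p + b * q < a * r + b * s := by
    intro p q r s hpr hqs
    rcases ha.eq_or_lt with rfl | ha
    · have : b = 1 := by linarith
      subst this; linarith
    · nlinarith
  obtain ⟨h1, h2, h3, h4, h5⟩ := hu
  obtain ⟨g1, g2, g3, g4, g5⟩ := hv
  have e1 := aux h1 g1
  have e2 := aux h2 g2
  have e3 := aux h3 g3
  have e4 := aux h4 g4
  have e5 := aux h5 g5
  have hb' : b = 1 - a := by linarith
  subst hb'
  refine ⟨?_, ?_, ?_, ?_, ?_⟩ <;>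
    simp only [Complex.add_re, Complex.add_im, Complex.real_smul, Complex.re_ofReal_mul,
      Complex.im_ofReal_mul] <;> linarith

theorem sq_le_one_sub_cos {y : ℝ} (hy0 : 0 ≤ y) (hy1 : y ≤ Real.pi) :
    2 / Real.pi ^ 2 * y ^ 2 ≤ 1 - Real.cos y := by
  have := Real.cos_le_one_sub_mul_cos_sq (x := y) (by rwa [abs_of_nonneg hy0])
  linarith

/-- For `x = re u ≥ 0` the imaginary part keeps distance at least `k x` from `0` and `2π`, so `‖e^u
- 1‖` is at least a multiple of `k x`, while `re (e^u - 1) ≤ 2 x`. The condition `4 ≤ k * κ`, with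
`π² ≤ 16`, makes the former win. -/
theorem exp_mem_slitDisc {ρ κ δ k : ℝ} (hρ : 1 ≤ ρ) (hκ : 0 < κ) (hk : 4 ≤ k * κ)
    (hδ1 : δ ≤ 1) (hδρ : Real.exp δ ≤ ρ) {u : ℂ} (hu : u ∈ logDomain δ k) :
    Complex.exp u ∈ slitDisc ρ κ := by
  obtain ⟨h1, h2, -, h4, -⟩ := hu
  set x := u.re with hx
  set y := u.im with hy
  have hnorm : ‖Complex.exp u‖ = Real.exp x := Complex.norm_exp u
  have hk0 : 0 < k := by by_contra! h; nlinarith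
  rcases lt_or_ge x 0 with hx0 | hx0
  · refine mem_slitDisc_of_norm_lt_one hρ hκ.le ?_
    rw [hnorm]; exact Real.exp_lt_one_iff.2 hx0
  refine ⟨?_, ?_⟩
  · rw [hnorm]; exact (Real.exp_lt_exp.2 h1).trans_le hδρ
  have hkx : 0 ≤ k * x := by positivity
  have hre : (Complex.exp u - 1).re = Real.exp x * Real.cos y - 1 := by
    rw [Complex.sub_re, Complex.exp_re, Complex.one_re]
  have him : (Complex.exp u - 1).im = Real.exp x * Real.sin y := by
    rw [Complex.sub_im, Complex.exp_im, Complex.one_im, sub_zero]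
  have hsq : ‖Complex.exp u - 1‖ ^ 2 = (Real.exp x - 1) ^ 2 + 2 * Real.exp x * (1 - Real.cos y) := by
    rw [Complex.sq_norm, Complex.normSq_apply, hre, him]
    linear_combination (Real.exp x) ^ 2 * Real.sin_sq_add_cos_sq y
  have hcos : 2 / Real.pi ^ 2 * (k * x) ^ 2 < 1 - Real.cos y := by
    have hpi : 0 < 2 / Real.pi ^ 2 := by positivity
    rcases le_or_gt y Real.pi with hyp | hyp
    · have := sq_le_one_sub_cos (hkx.trans h2.le) hyp
      have h6 : (k * x) ^ 2 < y ^ 2 := by gcongr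
      nlinarith
    · have := sq_le_one_sub_cos (y := 2 * Real.pi - y) (by linarith) (by linarith)
      rw [Real.cos_two_pi_sub] at this
      have h6 : (k * x) ^ 2 < (2 * Real.pi - y) ^ 2 := by gcongr
      nlinarith
  have hex1 : 1 ≤ Real.exp x := Real.one_le_exp hx0
  have hex2 : Real.exp x - 1 ≤ 2 * x := by
    have := Real.abs_exp_sub_one_le (x := x) (by rw [abs_of_nonneg hx0]; linarith)
    rw [abs_of_nonneg hx0] at this
    exact (le_abs_self _).trans this
  rw [hre]
  rcases lt_or_ge (Real.exp x * Real.cos y - 1) 0 with hneg | hpos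
  · exact hneg.trans_le (by positivity)
  have hb1 : Real.exp x * Real.cos y - 1 ≤ 2 * x := by
    have := mul_le_mul_of_nonneg_left (Real.cos_le_one y) (Real.exp_pos x).le
    linarith
  refine lt_of_pow_lt_pow_left₀ 2 (by positivity) ?_
  rw [mul_pow, hsq]
  have hpi2 : Real.pi ^ 2 ≤ 16 := by
    nlinarith [Real.pi_le_four, Real.pi_pos]
  have hc0 : 0 ≤ 1 - Real.cos y := by linarith [Real.cos_le_one y]
  calc (Real.exp x * Real.cos y - 1) ^ 2 ≤ (2 * x) ^ 2 := by gcongr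
    _ = 4 * 4 ^ 2 / 16 * x ^ 2 := by ring
    _ ≤ 4 * (k * κ) ^ 2 / Real.pi ^ 2 * x ^ 2 := by gcongr
    _ = κ ^ 2 * (2 * (2 / Real.pi ^ 2 * (k * x) ^ 2)) := by ring
    _ < κ ^ 2 * (2 * (1 - Real.cos y)) := by gcongr
    _ ≤ κ ^ 2 * ((Real.exp x - 1) ^ 2 + 2 * Real.exp x * (1 - Real.cos y)) := by
      gcongr
      nlinarith [sq_nonneg (Real.exp x - 1)]

/-- Growth of a primitive along a path that passes the origin at distance `1 / n` and then
follows a ray. -/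
theorem norm_primitive_sub_le {P G : ℂ → ℂ} {z₀ ω : ℂ} {b X n x₂ : ℝ} {S : Set ℂ}
    (hn : 0 < n) (hω : ω.re = 1) (hb : ‖ω‖ ≤ b) (him : 2 ≤ |ω.im|) (hX : 0 ≤ X)
    (hx : 1 / n ≤ x₂)
    (hSA : ∀ τ : ℝ, 0 ≤ τ → τ ≤ 1 → (-1 + τ * (1 + ω)) / n ∈ S)
    (hSB : ∀ x : ℝ, 1 / n ≤ x → x ≤ x₂ → x * ω ∈ S)
    (hP : ∀ v ∈ S, HasDerivAt P (G v) (z₀ + v))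
    (hG : ∀ v ∈ S, 1 / 2 ≤ n * ‖v‖ → ‖G v‖ ≤ X * Real.exp (n * ‖v‖ / (2 * b) - n * v.re)) :
    ‖P (z₀ + x₂ * ω) - P (z₀ + -1 / n)‖ ≤ (Real.exp (3 / 2) * (1 + b) + 2 * b) * X / n := by
  have hω1 : 1 ≤ ‖ω‖ := by
    have := Complex.abs_re_le_norm ω
    rwa [hω, abs_one] at this
  have hb0 : 0 < b := by linarith
  -- A segment from `-1/n` to `ω/n` passes the origin; there `n‖v‖ ≤ b` and `n * v.re ≥ -1`, whence
  -- the exponent `1/2 + 1 = 3/2`.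
  have hA : ‖P (z₀ + 1 / n * ω) - P (z₀ + -1 / n)‖ ≤ X * Real.exp (3 / 2) * ((1 + b) / n) := by
    have hder : ∀ τ ∈ Set.Icc (0 : ℝ) 1,
        HasDerivWithinAt (fun τ : ℝ => P (z₀ + (-1 + τ * (1 + ω)) / n))
          (G ((-1 + τ * (1 + ω)) / n) * ((1 + ω) / n)) (Set.Icc 0 1) τ := by
      intro τ hτ
      have h1 : HasDerivAt (fun τ : ℝ => z₀ + (-1 + τ * (1 + ω)) / n) ((1 + ω) / n) τ := by
        simpa using ((((Complex.ofRealCLM.hasDerivAt (x := τ)).mul_const (1 + ω)).const_add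
          (-1)).div_const (n : ℂ)).const_add z₀
      exact ((hP _ (hSA τ hτ.1 hτ.2)).comp τ h1).hasDerivWithinAt
    have hbd : ∀ τ ∈ Set.Ico (0 : ℝ) 1,
        ‖G ((-1 + τ * (1 + ω)) / n) * ((1 + ω) / n)‖ ≤ X * Real.exp (3 / 2) * ((1 + b) / n) := by
      intro τ hτ
      set v := (-1 + τ * (1 + ω)) / (n : ℂ) with hv
      have hnv : n * ‖v‖ = ‖-1 + τ * (1 + ω)‖ := by
        rw [hv, norm_div, Complex.norm_real, Real.norm_of_nonneg hn.le]
        field_simp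
      have hre : (-1 + τ * (1 + ω)).re = -1 + 2 * τ := by
        simp [hω]; ring
      have him' : (-1 + τ * (1 + ω)).im = τ * ω.im := by simp
      -- For `τ ≤ 1/4` the real part keeps the segment away from `0`, afterwards the imaginary part
      -- does, because `|ω.im| ≥ 2`.
      have hlow : 1 / 2 ≤ n * ‖v‖ := by
        rw [hnv]
        rcases le_or_gt τ (1 / 4) with h | h
        · refine le_trans ?_ (Complex.abs_re_le_norm _)
          rw [hre, abs_of_nonpos (by linarith)]
          linarith
        · refine le_trans ?_ (Complex.abs_im_le_norm _)
          rw [him', abs_mul, abs_of_nonneg (by linarith : 0 ≤ τ)]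
          nlinarith
      have hup : n * ‖v‖ ≤ b := by
        rw [hnv, show (-1 : ℂ) + τ * (1 + ω) = ((1 - τ : ℝ) : ℂ) * (-1) + (τ : ℝ) * ω by
          push_cast; ring]
        refine (norm_add_le _ _).trans ?_
        rw [norm_mul, norm_mul, Complex.norm_real, Complex.norm_real, norm_neg, norm_one,
          Real.norm_of_nonneg hτ.1, Real.norm_of_nonneg (by linarith [hτ.2] : 0 ≤ 1 - τ)]
        nlinarith [hτ.1, hτ.2]
      have hvre : n * v.re = -1 + 2 * τ := by
        rw [hv, Complex.div_ofReal_re, hre]; field_simp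
      have h1 := hG v (hSA τ hτ.1 hτ.2.le) hlow
      have h2 : n * ‖v‖ / (2 * b) - n * v.re ≤ 3 / 2 := by
        have : n * ‖v‖ / (2 * b) ≤ 1 / 2 := by
          rw [div_le_div_iff₀ (by positivity) (by norm_num)]; linarith
        rw [hvre]; linarith [hτ.1]
      rw [norm_mul]
      refine mul_le_mul (h1.trans ?_) ?_ (norm_nonneg _) (by positivity)
      · gcongr
      · rw [norm_div, Complex.norm_real, Real.norm_of_nonneg hn.le]
        gcongr
        refine (norm_add_le _ _).trans ?_
        rw [norm_one]; linarith
    have h := norm_image_sub_le_of_norm_deriv_le_segment_01' hder hbd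
    have e1 : ((-1 : ℂ) + ((1 : ℝ) : ℂ) * (1 + ω)) / n = 1 / n * ω := by push_cast; ring
    have e0 : ((-1 : ℂ) + ((0 : ℝ) : ℂ) * (1 + ω)) / n = -1 / n := by push_cast; ring
    simpa only [e1, e0] using h
  have hB : ‖P (z₀ + x₂ * ω) - P (z₀ + 1 / n * ω)‖ ≤ 2 * b * X / n := by
    have hder : ∀ x ∈ Set.Icc (1 / n) x₂,
        HasDerivAt (fun x : ℝ => P (z₀ + x * ω) - P (z₀ + 1 / n * ω)) (G (x * ω) * ω) x := by
      intro x hx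
      have h1 : HasDerivAt (fun x : ℝ => z₀ + x * ω) ω x := by
        simpa using (((Complex.ofRealCLM.hasDerivAt (x := x)).mul_const ω).const_add z₀)
      exact ((hP _ (hSB x hx.1 hx.2)).comp x h1).sub_const _
    -- The comparison function has the bound on the ray as its derivative, and it stays below
    -- `2bX/n` however long the ray is.
    have hBd : ∀ x : ℝ, HasDerivAt
        (fun x : ℝ => 2 * b * X / n * (1 - Real.exp (-(n / 2) * x)))
        (b * X * Real.exp (-(n / 2) * x)) x := by
      intro x
      have h1 : HasDerivAt (fun x : ℝ => -(n / 2) * x) (-(n / 2)) x := by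
        simpa using (hasDerivAt_id x).const_mul (-(n / 2))
      refine ((h1.exp.const_sub 1).const_mul (2 * b * X / n)).congr_deriv ?_
      field_simp
    have hbd : ∀ x ∈ Set.Ico (1 / n) x₂,
        ‖G (x * ω) * ω‖ ≤ b * X * Real.exp (-(n / 2) * x) := by
      intro x hx
      have hx0 : 0 < x := (one_div_pos.2 hn).trans_le hx.1
      have hnorm : ‖(x : ℂ) * ω‖ = x * ‖ω‖ := by
        rw [norm_mul, Complex.norm_real, Real.norm_of_nonneg hx0.le]
      have hnx : 1 ≤ n * x := by
        have := hx.1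
        rw [div_le_iff₀ hn] at this; linarith
      have h1 := hG _ (hSB x hx.1 hx.2.le) (by rw [hnorm]; nlinarith)
      -- As `‖ω‖ ≤ b`, the admitted growth of `G` consumes at most half of the decay `e^{-nx}`.
      have h2 : n * ‖(x : ℂ) * ω‖ / (2 * b) - n * ((x : ℂ) * ω).re ≤ -(n / 2) * x := by
        rw [hnorm, Complex.re_ofReal_mul, hω, mul_one]
        have : n * (x * ‖ω‖) / (2 * b) ≤ n * x / 2 := by
          rw [div_le_div_iff₀ (by positivity) (by norm_num)]
          have := mul_le_mul_of_nonneg_left hb (mul_pos hn hx0).le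
          linarith
        linarith
      rw [norm_mul]
      calc ‖G (x * ω)‖ * ‖ω‖ ≤ X * Real.exp (-(n / 2) * x) * b := by
            refine mul_le_mul (h1.trans ?_) hb (norm_nonneg _) (by positivity)
            gcongr
        _ = _ := by ring
    have h0 : ‖(fun x : ℝ => P (z₀ + x * ω) - P (z₀ + 1 / n * ω)) (1 / n)‖ ≤
        2 * b * X / n * (1 - Real.exp (-(n / 2) * (1 / n))) := by
      have : Real.exp (-(n / 2) * (1 / n)) ≤ 1 := by
        rw [Real.exp_le_one_iff]
        have : 0 ≤ n / 2 * (1 / n) := by positivity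
        linarith
      have h1 : 0 ≤ 1 - Real.exp (-(n / 2) * (1 / n)) := by linarith
      simp only [Complex.ofReal_div, Complex.ofReal_one, sub_self, norm_zero]
      positivity
    have h := image_norm_le_of_norm_deriv_right_le_deriv_boundary
      (fun x hx => (hder x hx).continuousAt.continuousWithinAt)
      (fun x hx => (hder x ⟨hx.1, hx.2.le⟩).hasDerivWithinAt) h0 hBd hbd ⟨hx, le_rfl⟩
    refine h.trans (mul_le_of_le_one_right (by positivity) ?_)
    linarith [Real.exp_pos (-(n / 2) * x₂)]
  have h := norm_sub_le_norm_sub_add_norm_sub (P (z₀ + x₂ * ω)) (P (z₀ + 1 / n * ω))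
    (P (z₀ + -1 / n))
  refine h.trans ((add_le_add hB hA).trans (le_of_eq ?_))
  field_simp
  ring

/-- The reflection exchanges the two ends of the contour, so one path estimate serves at both. -/
theorem two_pi_I_add_conj_mem_logDomain {δ k : ℝ} {u : ℂ} (hu : u ∈ logDomain δ k) :
    2 * Real.pi * Complex.I + starRingEnd ℂ u ∈ logDomain δ k := by
  obtain ⟨h1, h2, h3, h4, h5⟩ := hu
  have hre : (2 * Real.pi * Complex.I + starRingEnd ℂ u).re = u.re := by simp
  have him : (2 * Real.pi * Complex.I + starRingEnd ℂ u).im = 2 * Real.pi - u.im := by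
    simp [sub_eq_add_neg]
  refine ⟨?_, ?_, ?_, ?_, ?_⟩ <;> rw [hre] <;> (try rw [him]) <;> linarith

theorem arc_mem_logDomain {δ k n τ : ℝ} {ω : ℂ} (hre : ω.re = 1) (him : ω.im = 2 * k)
    (hk : 0 < k) (hkδ : 3 * k * δ ≤ 1) (hn : 0 < n) (hinv : 1 / n ≤ δ) (h0 : 0 ≤ τ)
    (h1 : τ ≤ 1) : (-1 + τ * (1 + ω)) / (n : ℂ) ∈ logDomain (2 * δ) k := by
  have hre' : ((-1 + τ * (1 + ω)) / (n : ℂ)).re = 2 * (τ / n) - 1 / n := by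
    rw [Complex.div_ofReal_re]
    simp only [Complex.add_re, Complex.neg_re, Complex.one_re, Complex.re_ofReal_mul, hre]
    ring
  have him' : ((-1 + τ * (1 + ω)) / (n : ℂ)).im = 2 * (k * (τ / n)) := by
    rw [Complex.div_ofReal_im]
    simp only [Complex.add_im, Complex.neg_im, Complex.one_im, Complex.im_ofReal_mul, him]
    ring
  have hτn : τ / n ≤ 1 / n := by gcongr
  have hτ0 : 0 ≤ τ / n := by positivity
  have hn0 : 0 < 1 / n := by positivity
  have hpi := Real.pi_gt_three
  have p1 : 0 ≤ k * (τ / n) := by positivity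
  have p2 : k * (τ / n) ≤ k * (1 / n) := by gcongr
  have p3 : 0 < k * (1 / n) := by positivity
  have p4 : k * (1 / n) ≤ k * δ := by gcongr
  refine ⟨?_, ?_, ?_, ?_, ?_⟩
  · rw [hre']; linarith
  all_goals rw [hre', him']; linarith

theorem norm_arc_le {b n τ : ℝ} {ω : ℂ} (hb : ‖ω‖ ≤ b) (hb1 : 1 ≤ b) (hn : 0 < n) (h0 : 0 ≤ τ)
    (h1 : τ ≤ 1) : ‖(-1 + τ * (1 + ω)) / (n : ℂ)‖ ≤ b / n := by
  rw [norm_div, Complex.norm_real, Real.norm_of_nonneg hn.le]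
  gcongr
  rw [show (-1 : ℂ) + τ * (1 + ω) = ((1 - τ : ℝ) : ℂ) * (-1) + (τ : ℝ) * ω by
    push_cast; ring]
  refine (norm_add_le _ _).trans ?_
  rw [norm_mul, norm_mul, Complex.norm_real, Complex.norm_real, norm_neg, norm_one,
    Real.norm_of_nonneg h0, Real.norm_of_nonneg (by linarith : 0 ≤ 1 - τ)]
  nlinarith

theorem ray_mem_logDomain {δ k x : ℝ} {ω : ℂ} (hre : ω.re = 1) (him : ω.im = 2 * k)
    (hk : 0 < k) (hkδ : 3 * k * δ ≤ 1) (hx0 : 0 < x) (hx : x ≤ δ) :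
    (x : ℂ) * ω ∈ logDomain (2 * δ) k := by
  have hre' : ((x : ℂ) * ω).re = x := by rw [Complex.re_ofReal_mul, hre, mul_one]
  have him' : ((x : ℂ) * ω).im = 2 * (k * x) := by rw [Complex.im_ofReal_mul, him]; ring
  have hpi := Real.pi_gt_three
  have p1 : 0 < k * x := by positivity
  have p2 : k * x ≤ k * δ := by gcongr
  refine ⟨?_, ?_, ?_, ?_, ?_⟩
  · rw [hre']; linarith
  all_goals rw [hre', him']; linarith

theorem norm_primitive_sub_le_of_re_eq {P G : ℂ → ℂ} {V : Set ℂ} (hV : Convex ℝ V)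
    (hP : ∀ u ∈ V, HasDerivAt P (G u) u) {p q : ℂ} (hp : p ∈ V) (hq : q ∈ V) {x C : ℝ}
    (hpx : p.re = x) (hqx : q.re = x) (hG : ∀ u ∈ V, u.re = x → ‖G u‖ ≤ C) :
    ‖P q - P p‖ ≤ C * ‖q - p‖ := by
  have hseg : segment ℝ p q ⊆ V := hV.segment_subset hp hq
  refine (convex_segment p q).norm_image_sub_le_of_norm_hasDerivWithin_le
    (fun u hu => (hP u (hseg hu)).hasDerivWithinAt) (fun u hu => hG u (hseg hu) ?_)
    (left_mem_segment ℝ _ _) (right_mem_segment ℝ _ _)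
  obtain ⟨α, β, -, -, hαβ, rfl⟩ := hu
  rw [Complex.add_re, Complex.real_smul, Complex.real_smul, Complex.re_ofReal_mul,
    Complex.re_ofReal_mul, hpx, hqx, ← add_mul, hαβ, one_mul]

/-- Bound for a Taylor coefficient by means of a contour that passes the singularity `1` at
distance of order `1 / n`, leaves the unit disc along two rays and closes up on the circle of
radius `exp (δ / d)`. -/
theorem norm_taylorCoeff_le {ρ κ δ k X M : ℝ} {f : ℂ → ℂ} {n d : ℕ} (hρ : 1 < ρ) (hκ : 0 < κ)
    (hκ1 : κ < 1) (hk : 4 ≤ k * κ) (hδ : 0 < δ) (hδk : δ * (1 + 2 * k) ≤ 1 / 2)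
    (hδρ : Real.exp (2 * δ) ≤ ρ) (hf : DifferentiableOn ℂ f (slitDisc ρ κ))
    (hd : 1 ≤ d) (hdn : d ≤ δ * n) (hX : 0 ≤ X) (hM : 0 ≤ M)
    (hnear : ∀ v : ℂ, Complex.exp v ∈ slitDisc ρ κ → 1 / 2 ≤ n * ‖v‖ → d * ‖v‖ ≤ 1 / 2 →
      ‖f (Complex.exp v)‖ ≤ X * Real.exp (n * ‖v‖ / (2 * (1 + 2 * k))))
    (hfar : ∀ t ∈ slitDisc ρ κ, ‖t‖ = Real.exp (δ / d) → ‖f t‖ ≤ M) :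
    ‖taylorCoeff f n‖ ≤ (Real.exp (3 / 2) * (1 + (1 + 2 * k)) + 2 * (1 + 2 * k)) * X / n +
      M * Real.exp (-(n * (δ / d))) := by
  have hk4 : 4 ≤ k := by nlinarith
  have hk0 : 0 < k := by linarith
  have hd1 : (1 : ℝ) ≤ d := by exact_mod_cast hd
  have hd0 : (0 : ℝ) ≤ d := by linarith
  have hn : (0 : ℝ) < n := by
    by_contra! h
    nlinarith
  have hpi := Real.pi_gt_three
  set b := 1 + 2 * k with hb
  have hb1 : 1 ≤ b := by linarith
  set V := logDomain (2 * δ) k with hV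
  have hδ1 : 2 * δ ≤ 1 := by nlinarith
  have hVmem : ∀ u ∈ V, Complex.exp u ∈ slitDisc ρ κ := fun u hu =>
    exp_mem_slitDisc hρ.le hκ hk hδ1 hδρ hu
  set G : ℂ → ℂ := fun u => f (Complex.exp u) * Complex.exp (-(n * u)) with hG
  have hGd : DifferentiableOn ℂ G V := by
    have h1 : DifferentiableOn ℂ (fun u => f (Complex.exp u)) V :=
      hf.comp (by fun_prop) hVmem
    exact h1.mul (by fun_prop)
  -- A primitive on the convex domain replaces contour deformation: the coefficient depends only on
  -- the values of `P` at `-1/n` and `-1/n + 2πi`, which any path in `V` may join.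
  obtain ⟨P, hP⟩ := (convex_logDomain (2 * δ) k).exists_forall_hasDerivWithinAt hGd
  have hP' : ∀ u ∈ V, HasDerivAt P (G u) u := fun u hu =>
    (hP u hu).hasDerivAt ((isOpen_logDomain (2 * δ) k).mem_nhds hu)
  set x₂ := δ / (d : ℝ) with hx₂
  have hx₂0 : 0 < x₂ := by positivity
  have hx₂δ : x₂ ≤ δ := div_le_self hδ.le hd1
  have hnx : 1 / (n : ℝ) ≤ x₂ := by
    rw [hx₂, div_le_div_iff₀ hn (by linarith)]; linarith
  have hkδ : 3 * k * δ ≤ 1 := by nlinarith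
  have hinv : (1 : ℝ) / n ≤ δ := hnx.trans hx₂δ
  -- The slope `2k` is steeper than the boundary slope `k` of the domain, so the ray lies inside it.
  set ω : ℂ := 1 + (2 * k : ℝ) * Complex.I with hω
  have hωre : ω.re = 1 := by simp [hω]
  have hωim : ω.im = 2 * k := by simp [hω]
  have hωn : ‖ω‖ ≤ b := by
    refine (norm_add_le _ _).trans ?_
    rw [norm_one, norm_mul, Complex.norm_I, mul_one, Complex.norm_real,
      Real.norm_of_nonneg (by linarith)]
  set S : Set ℂ := {v | v ∈ V ∧ d * ‖v‖ ≤ 1 / 2} with hS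
  have hSA : ∀ τ : ℝ, 0 ≤ τ → τ ≤ 1 → (-1 + τ * (1 + ω)) / (n : ℝ) ∈ S := by
    intro τ h0 h1
    refine ⟨arc_mem_logDomain hωre hωim hk0 hkδ hn hinv h0 h1, ?_⟩
    calc (d : ℝ) * ‖(-1 + τ * (1 + ω)) / ((n : ℝ) : ℂ)‖ ≤ d * (b / n) :=
          mul_le_mul_of_nonneg_left (norm_arc_le hωn hb1 hn h0 h1) hd0
      _ = d / n * b := by ring
      _ ≤ δ * b := mul_le_mul_of_nonneg_right ((div_le_iff₀ hn).2 hdn) (by linarith)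
      _ ≤ 1 / 2 := hδk
  have hSB : ∀ x : ℝ, 1 / (n : ℝ) ≤ x → x ≤ x₂ → x * ω ∈ S := by
    intro x h1 h2
    have hx0 : 0 < x := (one_div_pos.2 hn).trans_le h1
    refine ⟨ray_mem_logDomain hωre hωim hk0 hkδ hx0 (h2.trans hx₂δ), ?_⟩
    rw [norm_mul, Complex.norm_real, Real.norm_of_nonneg hx0.le]
    calc (d : ℝ) * (x * ‖ω‖) ≤ d * (x₂ * b) := by gcongr
      _ = δ * b := by rw [hx₂]; field_simp
      _ ≤ 1 / 2 := hδk
  have hGbound : ∀ v : ℂ, Complex.exp v ∈ slitDisc ρ κ → d * ‖v‖ ≤ 1 / 2 → 1 / 2 ≤ n * ‖v‖ →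
      ‖G v‖ ≤ X * Real.exp (n * ‖v‖ / (2 * b) - n * v.re) := by
    intro v hv h1 h2
    rw [hG, norm_mul, Complex.norm_exp, sub_eq_add_neg, Real.exp_add, ← mul_assoc]
    have : (-((n : ℂ) * v)).re = -(n * v.re) := by simp
    rw [this]
    gcongr
    exact hnear v hv h2 h1
  have hstart := norm_primitive_sub_le (P := P) (G := G) (z₀ := 0) (b := b) (S := S) hn hωre hωn
    (by rw [hωim, abs_of_nonneg (by linarith)]; linarith) hX hnx hSA hSB
    (fun v hv => by rw [zero_add]; exact hP' v hv.1)
    (fun v hv h => hGbound v (hVmem v hv.1) hv.2 h)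
  -- Since `n` is an integer, the integrand has period `2πi`; the bound for `G` at the origin thus
  -- transfers to `2πi`.
  have hGper : ∀ v : ℂ, G (2 * Real.pi * Complex.I + v) = G v := by
    intro v
    have h1 : Complex.exp (-(n * (2 * Real.pi * Complex.I + v))) = Complex.exp (-(n * v)) := by
      rw [mul_add, neg_add, Complex.exp_add, Complex.exp_neg, Complex.exp_nat_mul_two_pi_mul_I,
        inv_one, one_mul]
    simp only [hG]
    rw [h1, Complex.exp_add, Complex.exp_two_pi_mul_I, one_mul]
  have hconjS : ∀ v ∈ S, starRingEnd ℂ v ∈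
      {v : ℂ | 2 * Real.pi * Complex.I + v ∈ V ∧ d * ‖v‖ ≤ 1 / 2} := by
    intro v hv
    refine ⟨two_pi_I_add_conj_mem_logDomain hv.1, ?_⟩
    rw [RCLike.norm_conj]; exact hv.2
  have hend := norm_primitive_sub_le (P := P) (G := G) (z₀ := 2 * Real.pi * Complex.I) (b := b)
    (ω := starRingEnd ℂ ω)
    (S := {v : ℂ | 2 * Real.pi * Complex.I + v ∈ V ∧ d * ‖v‖ ≤ 1 / 2}) hn
    (by rw [Complex.conj_re, hωre]) (by rw [RCLike.norm_conj]; exact hωn)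
    (by rw [Complex.conj_im, abs_neg, hωim, abs_of_nonneg (by linarith)]; linarith) hX hnx
    (fun τ h0 h1 => by simpa using hconjS _ (hSA τ h0 h1))
    (fun x h0 h1 => by simpa using hconjS _ (hSB x h0 h1))
    (fun v hv => by rw [← hGper v]; exact hP' _ hv.1)
    (fun v hv h => hGbound v (by
      have := hVmem _ hv.1
      rwa [Complex.exp_add, Complex.exp_two_pi_mul_I, one_mul] at this) hv.2 h)
  have hp₂ : 0 + x₂ * ω ∈ V := by rw [zero_add]; exact (hSB x₂ hnx le_rfl).1
  have hp₃ : 2 * Real.pi * Complex.I + x₂ * starRingEnd ℂ ω ∈ V := by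
    simpa using (hconjS _ (hSB x₂ hnx le_rfl)).1
  have hre₂ : (0 + x₂ * ω).re = x₂ := by rw [zero_add, Complex.re_ofReal_mul, hωre, mul_one]
  have hre₃ : (2 * Real.pi * Complex.I + x₂ * starRingEnd ℂ ω).re = x₂ := by
    rw [Complex.add_re, Complex.re_ofReal_mul, Complex.conj_re, hωre]; simp
  have hmid : ‖P (2 * Real.pi * Complex.I + x₂ * starRingEnd ℂ ω) - P (0 + x₂ * ω)‖ ≤
      M * Real.exp (-(n * x₂)) * (2 * Real.pi) := by
    have h := norm_primitive_sub_le_of_re_eq (convex_logDomain (2 * δ) k) hP' hp₂ hp₃ hre₂ hre₃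
      (C := M * Real.exp (-(n * x₂))) (fun u hu hux => by
        rw [hG, norm_mul, Complex.norm_exp (-((n : ℂ) * u))]
        have : (-((n : ℂ) * u)).re = -(n * x₂) := by rw [← hux]; simp
        rw [this]
        exact mul_le_mul_of_nonneg_right
          (hfar _ (hVmem u hu) (by rw [Complex.norm_exp, hux])) (Real.exp_pos _).le)
    refine h.trans (mul_le_mul_of_nonneg_left ?_ (by positivity))
    -- The two rays end at the same real part `x₂`; the vertical segment between their ends has
    -- length at most `2π`.
    have e : 2 * Real.pi * Complex.I + x₂ * starRingEnd ℂ ω - (0 + x₂ * ω) =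
        ((2 * Real.pi - 4 * k * x₂ : ℝ) : ℂ) * Complex.I := by
      apply Complex.ext
      · rw [Complex.sub_re, hre₂, hre₃]; simp
      · simp [hωim]; ring
    rw [e, norm_mul, Complex.norm_I, mul_one, Complex.norm_real, Real.norm_eq_abs, abs_le]
    have hkx : 0 ≤ k * x₂ := by positivity
    have hkx' : k * x₂ ≤ k * δ := by gcongr
    constructor <;> linarith
  have hball : DifferentiableOn ℂ f (Metric.ball 0 1) := hf.mono fun z hz =>
    mem_slitDisc_of_norm_lt_one hρ.le hκ.le (by simpa using hz)
  have hn1 : (0 : ℝ) < 1 / n := by positivity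
  have hco := taylorCoeff_eq_primitive hball n hn1 (P := P) (fun y hy => by
    have hkn : 0 < k * (1 / (n : ℝ)) := by positivity
    have hre : (-((1 / (n : ℝ) : ℝ) : ℂ) + y * Complex.I).re = -(1 / (n : ℝ)) := by
      rw [Complex.add_re, Complex.neg_re, Complex.ofReal_re, Complex.re_ofReal_mul, Complex.I_re]
      ring
    have him : (-((1 / (n : ℝ) : ℝ) : ℂ) + y * Complex.I).im = y := by
      rw [Complex.add_im, Complex.neg_im, Complex.ofReal_im, Complex.im_ofReal_mul, Complex.I_im]
      ring
    refine hP' _ ⟨?_, ?_, ?_, ?_, ?_⟩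
    · rw [hre]; linarith
    all_goals rw [hre, him]; linarith [hy.1, hy.2])
  have ea : -((1 / (n : ℝ) : ℝ) : ℂ) = 0 + -1 / ((n : ℝ) : ℂ) := by push_cast; ring
  have eb : -((1 / (n : ℝ) : ℝ) : ℂ) + ((2 * Real.pi : ℝ) : ℂ) * Complex.I =
      2 * Real.pi * Complex.I + -1 / ((n : ℝ) : ℂ) := by push_cast; ring
  rw [eb, ea] at hco
  set C := (Real.exp (3 / 2) * (1 + b) + 2 * b) * X / n with hC
  have hC0 : 0 ≤ C := by positivity
  have hnpi : ‖(2 : ℂ) * Real.pi * Complex.I‖ = 2 * Real.pi := by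
    rw [norm_mul, norm_mul, Complex.norm_I, Complex.norm_real, Real.norm_of_nonneg Real.pi_pos.le]
    simp
  rw [hco, norm_div, hnpi, div_le_iff₀ (by positivity)]
  rw [norm_sub_rev] at hend
  have t1 := norm_sub_le_norm_sub_add_norm_sub
    (P (2 * Real.pi * Complex.I + -1 / ((n : ℝ) : ℂ)))
    (P (2 * Real.pi * Complex.I + x₂ * starRingEnd ℂ ω)) (P (0 + -1 / ((n : ℝ) : ℂ)))
  have t2 := norm_sub_le_norm_sub_add_norm_sub
    (P (2 * Real.pi * Complex.I + x₂ * starRingEnd ℂ ω)) (P (0 + x₂ * ω))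
    (P (0 + -1 / ((n : ℝ) : ℂ)))
  have t3 : C * 6 ≤ C * (2 * Real.pi) := mul_le_mul_of_nonneg_left (by linarith) hC0
  rw [add_mul]
  linarith

/-! ### Estimates for the error function -/

/-- The polynomial `∑ m ∈ D, c_m / m * (t ^ m - 1)`. -/
noncomputable def shiftedPoly (c : ℕ → ℝ) (D : Finset ℕ) (t : ℂ) : ℂ :=
  ∑ m ∈ D, ((c m / m : ℝ) : ℂ) * (t ^ m - 1)

theorem norm_pow_le_exp_one {d m : ℕ} (hd : 1 ≤ d) (hm : m ≤ d) {t : ℂ}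
    (ht : ‖t‖ ≤ Real.exp (1 / d)) : ‖t ^ m‖ ≤ Real.exp 1 := by
  have hd' : (0 : ℝ) < d := by exact_mod_cast hd
  have hm' : (m : ℝ) ≤ d := by exact_mod_cast hm
  rw [norm_pow]
  refine (pow_le_pow_left₀ (norm_nonneg _) ht m).trans ?_
  rw [← Real.exp_nat_mul]
  apply Real.exp_le_exp.2
  rw [mul_one_div, div_le_one hd']
  exact hm'

theorem norm_pow_sub_one_le {d m : ℕ} (hd : 1 ≤ d) (hm : m ≤ d) {t : ℂ}
    (ht : ‖t‖ ≤ Real.exp (1 / d)) : ‖t ^ m - 1‖ ≤ m * (Real.exp 1 * ‖t - 1‖) := by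
  rw [← mul_geom_sum, norm_mul]
  have h : ‖∑ j ∈ Finset.range m, t ^ j‖ ≤ ∑ _j ∈ Finset.range m, Real.exp 1 :=
    norm_sum_le_of_le _ fun j hj =>
      norm_pow_le_exp_one hd ((Finset.mem_range.1 hj).le.trans hm) ht
  rw [Finset.sum_const, Finset.card_range, nsmul_eq_mul] at h
  calc ‖t - 1‖ * ‖∑ j ∈ Finset.range m, t ^ j‖ ≤ ‖t - 1‖ * (m * Real.exp 1) := by gcongr
    _ = _ := by ring

section Poly

variable {c : ℕ → ℝ} {D : Finset ℕ} {d : ℕ}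

/-- The factorization `t^m - 1 = (t - 1) ∑ t^j` produces a factor `m` that cancels the denominator.
This bound serves near the singularity, where `d * ‖t - 1‖` is bounded. -/
theorem norm_shiftedPoly_le (hc : ∀ m, 1 ≤ m → 0 ≤ c m) {C : ℝ} (hd : 1 ≤ d)
    (hD : D ⊆ Finset.Icc 1 d) (hC : ∑ m ∈ Finset.Icc 1 d, c m ≤ C * d) {t : ℂ}
    (ht : ‖t‖ ≤ Real.exp (1 / d)) :
    ‖shiftedPoly c D t‖ ≤ Real.exp 1 * C * d * ‖t - 1‖ := by
  have h1 : ‖shiftedPoly c D t‖ ≤ ∑ m ∈ D, c m * (Real.exp 1 * ‖t - 1‖) := by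
    refine norm_sum_le_of_le _ fun m hm => ?_
    have hm' := Finset.mem_Icc.1 (hD hm)
    have hm0 : (0 : ℝ) < m := by exact_mod_cast hm'.1
    have hcm := hc m hm'.1
    rw [norm_mul, Complex.norm_real, Real.norm_of_nonneg (by positivity)]
    calc c m / m * ‖t ^ m - 1‖ ≤ c m / m * (m * (Real.exp 1 * ‖t - 1‖)) := by
          gcongr
          exact norm_pow_sub_one_le hd hm'.2 ht
      _ = _ := by field_simp
  rw [← Finset.sum_mul] at h1
  have h2 : ∑ m ∈ D, c m ≤ ∑ m ∈ Finset.Icc 1 d, c m :=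
    Finset.sum_le_sum_of_subset_of_nonneg hD fun m hm _ => hc m (Finset.mem_Icc.1 hm).1
  calc _ ≤ (∑ m ∈ D, c m) * (Real.exp 1 * ‖t - 1‖) := h1
    _ ≤ C * d * (Real.exp 1 * ‖t - 1‖) := by
      gcongr
      exact h2.trans hC
    _ = _ := by ring

/-- Away from the singularity the crude bound `‖t^m - 1‖ ≤ e + 1 ≤ 4` suffices: after exponentiation
a logarithm costs only a power of `n`. -/
theorem norm_shiftedPoly_le_log (hc : ∀ m, 1 ≤ m → 0 ≤ c m) {C : ℝ} (hd : 1 ≤ d)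
    (hD : D ⊆ Finset.Icc 1 d) (hC : ∑ m ∈ Finset.Icc 1 d, c m / m ≤ C * (1 + Real.log d)) {t : ℂ}
    (ht : ‖t‖ ≤ Real.exp (1 / d)) :
    ‖shiftedPoly c D t‖ ≤ 4 * C * (1 + Real.log d) := by
  have hnn : ∀ m ∈ Finset.Icc 1 d, 0 ≤ c m / m := fun m hm =>
    div_nonneg (hc m (Finset.mem_Icc.1 hm).1) (Nat.cast_nonneg _)
  have h1 : ‖shiftedPoly c D t‖ ≤ ∑ m ∈ D, c m / m * 4 := by
    refine norm_sum_le_of_le _ fun m hm => ?_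
    rw [norm_mul, Complex.norm_real, Real.norm_of_nonneg (hnn m (hD hm))]
    refine mul_le_mul_of_nonneg_left ?_ (hnn m (hD hm))
    refine (norm_sub_le _ _).trans ?_
    have h2 := norm_pow_le_exp_one hd (Finset.mem_Icc.1 (hD hm)).2 ht
    rw [norm_one]
    linarith [Real.exp_one_lt_d9]
  rw [← Finset.sum_mul] at h1
  have h2 : ∑ m ∈ D, c m / m ≤ ∑ m ∈ Finset.Icc 1 d, c m / m :=
    Finset.sum_le_sum_of_subset_of_nonneg hD fun m hm _ => hnn m hm
  linarith

end Poly

/-- The difference between the generating function, normalized at its singularity, and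
`(1 - t) ^ (-w ϑ)`. -/
noncomputable def errorFun (ϑ : ℝ) (q : ℂ → ℂ) (c : ℕ → ℝ) (D : Finset ℕ) (w t : ℂ) : ℂ :=
  Complex.exp (w * ϑ * -Complex.log (1 - t)) * (Complex.exp (w * (q t - shiftedPoly c D t)) - 1)

theorem differentiableOn_errorFun {ρ κ ϑ : ℝ} (hκ : κ ≤ 1) {q : ℂ → ℂ} (c : ℕ → ℝ) (D : Finset ℕ)
    (w : ℂ) (hq : DifferentiableOn ℂ q (slitDisc ρ κ)) :
    DifferentiableOn ℂ (errorFun ϑ q c D w) (slitDisc ρ κ) := by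
  have h1 : DifferentiableOn ℂ (fun t : ℂ => Complex.log (1 - t)) (slitDisc ρ κ) :=
    DifferentiableOn.clog (by fun_prop) fun z hz => one_sub_mem_slitPlane hκ hz
  have h2 : DifferentiableOn ℂ (shiftedPoly c D) (slitDisc ρ κ) := by
    unfold shiftedPoly
    fun_prop
  exact ((h1.neg.const_mul _).cexp).mul (((hq.sub h2).const_mul w).cexp.sub_const 1)

theorem norm_exp_mul_neg_log_le {a t : ℂ} {A : ℝ} (ha : ‖a‖ ≤ A) :
    ‖Complex.exp (a * -Complex.log (1 - t))‖ ≤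
      Real.exp (-a.re * Real.log ‖t - 1‖) * Real.exp (Real.pi * A) := by
  rw [Complex.norm_exp, ← Real.exp_add]
  apply Real.exp_le_exp.2
  have h1 : (a * -Complex.log (1 - t)).re =
      -a.re * Real.log ‖t - 1‖ + a.im * Complex.arg (1 - t) := by
    rw [Complex.mul_re, Complex.neg_re, Complex.neg_im, Complex.log_re, Complex.log_im,
      norm_sub_rev]
    ring
  rw [h1]
  have h2 : a.im * Complex.arg (1 - t) ≤ Real.pi * A := by
    refine (le_abs_self _).trans ?_
    rw [abs_mul, mul_comm]
    exact mul_le_mul (Complex.abs_arg_le_pi _) ((Complex.abs_im_le_norm a).trans ha) (abs_nonneg _)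
      Real.pi_pos.le
  linarith

theorem half_norm_le_norm_exp_sub_one {v : ℂ} (hv : ‖v‖ ≤ 1 / 2) :
    ‖v‖ / 2 ≤ ‖Complex.exp v - 1‖ ∧ ‖Complex.exp v - 1‖ ≤ 2 * ‖v‖ := by
  have h1 := Complex.norm_exp_sub_one_sub_id_le (x := v) (by linarith)
  have h2 : ‖v‖ ^ 2 ≤ ‖v‖ / 2 := by nlinarith [norm_nonneg v]
  have h3 := norm_sub_norm_le v (v - (Complex.exp v - 1))
  have h4 := norm_add_le (Complex.exp v - 1 - v) v
  rw [norm_sub_rev v (Complex.exp v - 1)] at h3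
  rw [sub_sub_cancel] at h3
  rw [sub_add_cancel] at h4
  constructor <;> linarith [norm_nonneg v]

/-- With `x` the distance to the singularity, `x^{1-α}` is `n^{α-1}` times a power of `n x`. Since
`Y = 4nx ≥ 1`, that power is at most `Y^(A+1)` up to a constant, and one term of the exponential
series absorbs it; `16 b` comes from `Y ≤ 8 n z`. -/
theorem exp_neg_mul_log_mul_le {α b x z n : ℝ} {A : ℕ} (hα : |α| ≤ A) (hb : 0 < b) (hn : 0 < n)
    (hx : 1 / 4 ≤ n * x) (hxz : x ≤ 2 * z) :
    Real.exp (-α * Real.log x) * x ≤ 4 ^ A * ((16 * b) ^ (A + 1) * (A + 1).factorial) *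
      Real.exp ((α - 1) * Real.log n) * Real.exp (n * z / (2 * b)) := by
  have hx0 : 0 < x := by
    by_contra! h
    nlinarith
  have hz0 : 0 < z := by linarith
  set Y := 4 * (n * x) with hY
  have hY1 : 1 ≤ Y := by linarith
  have hY0 : 0 < Y := by linarith
  have hlogY : 0 ≤ Real.log Y := Real.log_nonneg hY1
  have hlog4 : 0 ≤ Real.log 4 := Real.log_nonneg (by norm_num)
  have hlogx : Real.log x = Real.log Y - Real.log 4 - Real.log n := by
    rw [hY, Real.log_mul (by norm_num) (by positivity), Real.log_mul hn.ne' hx0.ne']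
    ring
  have hxY : x = Y / 4 * Real.exp (-Real.log n) := by
    rw [Real.exp_neg, Real.exp_log hn, hY]; field_simp
  have h1 : Real.exp (-α * Real.log x) ≤ Y ^ A * 4 ^ A * Real.exp (α * Real.log n) := by
    have e1 : Y ^ A = Real.exp (A * Real.log Y) := by
      rw [Real.exp_nat_mul, Real.exp_log hY0]
    have e2 : (4 : ℝ) ^ A = Real.exp (A * Real.log 4) := by
      rw [Real.exp_nat_mul, Real.exp_log (by norm_num)]
    rw [e1, e2, ← Real.exp_add, ← Real.exp_add]
    apply Real.exp_le_exp.2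
    rw [hlogx]
    have h2 := mul_le_mul_of_nonneg_right (neg_le_of_abs_le hα) hlogY
    have h3 := mul_le_mul_of_nonneg_right (le_of_abs_le hα) hlog4
    nlinarith
  have h2 : Y ^ (A + 1) ≤ (16 * b) ^ (A + 1) * (A + 1).factorial * Real.exp (n * z / (2 * b)) := by
    have h3 := Real.pow_div_factorial_le_exp (n * z / (2 * b)) (by positivity) (A + 1)
    rw [div_le_iff₀ (by positivity)] at h3
    have h4 : Y ≤ 16 * b * (n * z / (2 * b)) := by
      rw [hY]
      field_simp
      nlinarith
    calc Y ^ (A + 1) ≤ (16 * b * (n * z / (2 * b))) ^ (A + 1) := by gcongr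
      _ = (16 * b) ^ (A + 1) * (n * z / (2 * b)) ^ (A + 1) := mul_pow _ _ _
      _ ≤ (16 * b) ^ (A + 1) * (Real.exp (n * z / (2 * b)) * (A + 1).factorial) := by gcongr
      _ = _ := by ring
  calc Real.exp (-α * Real.log x) * x
      = Real.exp (-α * Real.log x) * (Y / 4 * Real.exp (-Real.log n)) := by rw [← hxY]
    _ ≤ Y ^ A * 4 ^ A * Real.exp (α * Real.log n) * (Y * Real.exp (-Real.log n)) := by
      gcongr
      linarith
    _ = 4 ^ A * Real.exp ((α - 1) * Real.log n) * Y ^ (A + 1) := by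
      rw [show (α - 1) * Real.log n = α * Real.log n + -Real.log n by ring, Real.exp_add]
      ring
    _ ≤ 4 ^ A * Real.exp ((α - 1) * Real.log n) *
        ((16 * b) ^ (A + 1) * (A + 1).factorial * Real.exp (n * z / (2 * b))) := by gcongr
    _ = _ := by ring

section ErrorBounds

variable {ρ κ ϑ M W C₁ C₂ : ℝ} {q : ℂ → ℂ} {c : ℕ → ℝ} {D : Finset ℕ} {d n A : ℕ} {w : ℂ}

/-- Bound for `errorFun` near the singularity. -/
theorem norm_errorFun_le_near (hc : ∀ m, 1 ≤ m → 0 ≤ c m) (hM : 0 ≤ M) (hC₁ : 0 ≤ C₁)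
    (hq : ∀ z ∈ slitDisc ρ κ, ‖q z‖ ≤ M * ‖z - 1‖) (hd : 1 ≤ d) (hD : D ⊆ Finset.Icc 1 d)
    (hC : ∑ m ∈ Finset.Icc 1 d, c m ≤ C₁ * d) (hw : ‖w‖ ≤ W) (hA : ‖w * (ϑ : ℂ)‖ ≤ A) {b : ℝ}
    (hb : 0 < b) (hn : 0 < n) {v : ℂ} (hv : Complex.exp v ∈ slitDisc ρ κ)
    (hnv : 1 / 2 ≤ n * ‖v‖) (hdv : d * ‖v‖ ≤ 1 / 2) :
    ‖errorFun ϑ q c D w (Complex.exp v)‖ ≤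
      Real.exp (Real.pi * A) * (4 ^ A * ((16 * b) ^ (A + 1) * (A + 1).factorial)) *
      (W * (M + Real.exp 1 * C₁) * Real.exp (W * (M + Real.exp 1 * C₁))) *
      (d * Real.exp (((w * (ϑ : ℂ)).re - 1) * Real.log n)) * Real.exp (n * ‖v‖ / (2 * b)) := by
  have hd' : (1 : ℝ) ≤ d := by exact_mod_cast hd
  have hn' : (0 : ℝ) < n := by exact_mod_cast hn
  have hW : 0 ≤ W := (norm_nonneg _).trans hw
  have hv2 : ‖v‖ ≤ 1 / 2 := by nlinarith [norm_nonneg v]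
  obtain ⟨hx1, hx2⟩ := half_norm_le_norm_exp_sub_one hv2
  set t := Complex.exp v with ht
  set x := ‖t - 1‖ with hx
  set B := W * (M + Real.exp 1 * C₁) with hB
  have hB0 : 0 ≤ B := by positivity
  have htnorm : ‖t‖ ≤ Real.exp (1 / d) := by
    rw [ht, Complex.norm_exp]
    apply Real.exp_le_exp.2
    rw [le_div_iff₀ (by linarith)]
    nlinarith [Complex.re_le_norm v, norm_nonneg v]
  have hx0 : 0 ≤ x := norm_nonneg _
  have hz : ‖w * (q t - shiftedPoly c D t)‖ ≤ B * (d * x) := by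
    rw [norm_mul]
    have h1 : ‖q t - shiftedPoly c D t‖ ≤ (M + Real.exp 1 * C₁) * (d * x) := by
      refine (norm_sub_le _ _).trans ?_
      have h2 := hq t hv
      have h3 := norm_shiftedPoly_le hc hd hD hC htnorm
      have h4 : M * x ≤ M * (d * x) := by gcongr; nlinarith
      rw [← hx] at h2 h3
      linarith
    rw [hB, mul_assoc]
    gcongr
  have hdx : d * x ≤ 1 := by nlinarith
  have hdx0 : 0 ≤ d * x := by positivity
  -- Because `d * x ≤ 1`, the exponent is bounded and `exp - 1` is linear in `d * x`: the `d` yields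
  -- the numerator of `d / n`, the `x` the gain `1 / n`.
  have h1 : ‖Complex.exp (w * (q t - shiftedPoly c D t)) - 1‖ ≤ B * (d * x) * Real.exp B := by
    refine (norm_exp_sub_one_le_mul_exp _).trans ?_
    gcongr
    exact hz.trans (mul_le_of_le_one_right hB0 hdx)
  have h2 := norm_exp_mul_neg_log_le (t := t) hA
  have h3 := exp_neg_mul_log_mul_le (α := (w * (ϑ : ℂ)).re) (b := b) (x := x) (z := ‖v‖)
    (n := n) (A := A) ((Complex.abs_re_le_norm _).trans hA) hb hn' (by nlinarith) hx2
  rw [errorFun, norm_mul]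
  refine (mul_le_mul h2 h1 (norm_nonneg _) (by positivity)).trans ?_
  calc Real.exp (-(w * (ϑ : ℂ)).re * Real.log x) * Real.exp (Real.pi * A) *
        (B * (d * x) * Real.exp B)
      = Real.exp (Real.pi * A) * (B * Real.exp B) * d *
          (Real.exp (-(w * (ϑ : ℂ)).re * Real.log x) * x) := by ring
    _ ≤ Real.exp (Real.pi * A) * (B * Real.exp B) * d * (4 ^ A * ((16 * b) ^ (A + 1) *
          (A + 1).factorial) * Real.exp (((w * (ϑ : ℂ)).re - 1) * Real.log n) *
          Real.exp (n * ‖v‖ / (2 * b))) := by gcongr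
    _ = _ := by ring

/-- Bound for `errorFun` on the part of the contour away from the singularity. -/
theorem norm_errorFun_le_far {δ : ℝ} (hc : ∀ m, 1 ≤ m → 0 ≤ c m) (hM : 0 ≤ M) (hC₂ : 0 ≤ C₂)
    (hρ : 1 < ρ)
    (hq : ∀ z ∈ slitDisc ρ κ, ‖q z‖ ≤ M * ‖z - 1‖) (hd : 1 ≤ d) (hD : D ⊆ Finset.Icc 1 d)
    (hC : ∑ m ∈ Finset.Icc 1 d, c m / m ≤ C₂ * (1 + Real.log d)) (hw : ‖w‖ ≤ W)
    (hA : ‖w * (ϑ : ℂ)‖ ≤ A) (hδ1 : δ ≤ 1) (hdn : d ≤ δ * n) (hdn' : d ≤ n)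
    {t : ℂ} (ht : t ∈ slitDisc ρ κ) (htn : ‖t‖ = Real.exp (δ / d)) :
    ‖errorFun ϑ q c D w t‖ ≤
      Real.exp (Real.pi * A) * (2 * Real.exp (A * Real.log (ρ + 1) + W * (M * (ρ + 1)) +
        4 * W * C₂)) * Real.exp ((A + 4 * W * C₂) * Real.log n) := by
  have hd' : (1 : ℝ) ≤ d := by exact_mod_cast hd
  have hdnr : (d : ℝ) ≤ n := by exact_mod_cast hdn'
  have hn1 : (1 : ℝ) ≤ n := hd'.trans hdnr
  have hW : 0 ≤ W := (norm_nonneg _).trans hw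
  have hlogn : 0 ≤ Real.log n := Real.log_nonneg hn1
  have hlogρ : 0 ≤ Real.log (ρ + 1) := Real.log_nonneg (by linarith)
  set x := ‖t - 1‖ with hx
  have hxlow : 1 / (n : ℝ) ≤ x := by
    have h1 := norm_sub_norm_le t 1
    rw [norm_one, htn] at h1
    have h2 := Real.add_one_le_exp (δ / (d : ℝ))
    have h3 : 1 / (n : ℝ) ≤ δ / d := by
      rw [div_le_div_iff₀ (by linarith) (by linarith)]; linarith
    linarith
  have hxup : x ≤ ρ + 1 := by
    have := norm_sub_le t 1
    rw [norm_one] at this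
    exact this.trans (by linarith [ht.1])
  have hx0 : 0 < x := lt_of_lt_of_le (by positivity) hxlow
  -- Bounding `log x` on both sides handles either sign of the real part of `w * ϑ`.
  have hlogx : |Real.log x| ≤ Real.log n + Real.log (ρ + 1) := by
    rw [abs_le]
    have h1 := Real.log_le_log (by positivity) hxlow
    have h2 := Real.log_le_log hx0 hxup
    rw [one_div, Real.log_inv] at h1
    constructor <;> linarith
  have h2 := norm_exp_mul_neg_log_le (t := t) hA
  have h3 : Real.exp (-(w * (ϑ : ℂ)).re * Real.log x) ≤
      Real.exp (A * (Real.log n + Real.log (ρ + 1))) := by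
    apply Real.exp_le_exp.2
    refine (le_abs_self _).trans ?_
    rw [abs_mul, abs_neg]
    exact mul_le_mul ((Complex.abs_re_le_norm _).trans hA) hlogx (abs_nonneg _) (Nat.cast_nonneg _)
  have htd : ‖t‖ ≤ Real.exp (1 / d) := by
    rw [htn]; gcongr
  have hz : ‖w * (q t - shiftedPoly c D t)‖ ≤
      W * (M * (ρ + 1)) + 4 * W * C₂ + 4 * W * C₂ * Real.log n := by
    rw [norm_mul]
    have h1 : ‖q t - shiftedPoly c D t‖ ≤ M * (ρ + 1) + 4 * C₂ * (1 + Real.log n) := by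
      refine (norm_sub_le _ _).trans (add_le_add ?_ ?_)
      · exact (hq t ht).trans (by gcongr)
      · refine (norm_shiftedPoly_le_log hc hd hD hC htd).trans ?_
        gcongr
    calc ‖w‖ * ‖q t - shiftedPoly c D t‖ ≤ W * (M * (ρ + 1) + 4 * C₂ * (1 + Real.log n)) := by
          gcongr
      _ = _ := by ring
  have h1 : ‖Complex.exp (w * (q t - shiftedPoly c D t)) - 1‖ ≤
      2 * Real.exp (W * (M * (ρ + 1)) + 4 * W * C₂ + 4 * W * C₂ * Real.log n) := by
    refine (norm_sub_le _ _).trans ?_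
    have e1 := (Complex.norm_exp_le_exp_norm (w * (q t - shiftedPoly c D t))).trans
      (Real.exp_le_exp.2 hz)
    have e2 : 1 ≤ Real.exp (W * (M * (ρ + 1)) + 4 * W * C₂ + 4 * W * C₂ * Real.log n) :=
      Real.one_le_exp ((norm_nonneg _).trans hz)
    rw [norm_one]
    linarith
  rw [errorFun, norm_mul]
  refine (mul_le_mul (h2.trans (mul_le_mul_of_nonneg_right h3 (Real.exp_pos _).le)) h1
    (norm_nonneg _) (by positivity)).trans (le_of_eq ?_)
  rw [show (A + 4 * W * C₂) * Real.log n = A * Real.log n + 4 * W * C₂ * Real.log n by ring,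
    mul_add]
  simp only [Real.exp_add]
  ring

end ErrorBounds

theorem one_le_d (A : ℕ → Finset ℕ) (n : ℕ) : 1 ≤ d A n := by
  unfold d
  split_ifs with hD
  · exact (Finset.mem_Icc.1 (Finset.mem_sdiff.1 (Finset.max'_mem _ hD)).1).1
  · exact le_rfl

theorem D_subset_Icc_d (A : ℕ → Finset ℕ) (n : ℕ) : D A n ⊆ Finset.Icc 1 (d A n) := by
  intro m hm
  have hD : (D A n).Nonempty := ⟨m, hm⟩
  rw [Finset.mem_Icc, d, dif_pos hD]
  exact ⟨(Finset.mem_Icc.1 (Finset.mem_sdiff.1 hm).1).1, Finset.le_max' _ _ hm⟩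

/-- The Taylor coefficients of `errorFun` are smaller by a factor `d_n / n` than those of
`(1 - t) ^ (-w ϑ)`, uniformly for bounded `w`. -/
theorem exists_norm_taylorCoeff_errorFun_le {ρ κ ϑ M W C₁ C₂ : ℝ} {q : ℂ → ℂ} {c : ℕ → ℝ}
    {D : ℕ → Finset ℕ} {d : ℕ → ℕ} (hρ : 1 < ρ) (hκ : 0 < κ) (hκ1 : κ < 1)
    (hc : ∀ m, 1 ≤ m → 0 ≤ c m) (hM : 0 ≤ M) (hW : 0 ≤ W) (hC₁ : 0 ≤ C₁) (hC₂ : 0 ≤ C₂)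
    (hqd : DifferentiableOn ℂ q (slitDisc ρ κ))
    (hq : ∀ z ∈ slitDisc ρ κ, ‖q z‖ ≤ M * ‖z - 1‖)
    (hC1 : ∀ d : ℕ, 1 ≤ d → ∑ m ∈ Finset.Icc 1 d, c m ≤ C₁ * d)
    (hC2 : ∀ d : ℕ, 1 ≤ d → ∑ m ∈ Finset.Icc 1 d, c m / m ≤ C₂ * (1 + Real.log d))
    (hd1 : ∀ n, 1 ≤ d n) (hD : ∀ n, D n ⊆ Finset.Icc 1 (d n))
    (hd : ∀ C : ℝ, Tendsto (fun n : ℕ => C * Real.log n - n / d n) atTop atBot) :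
    ∃ C, 0 ≤ C ∧ ∀ᶠ n : ℕ in atTop, ∀ w : ℂ, ‖w‖ ≤ W →
      ‖taylorCoeff (errorFun ϑ q c (D n) w) n‖ ≤
        C * (d n / n) * Real.exp (((w * (ϑ : ℂ)).re - 1) * Real.log n) := by
  set k := 4 / κ with hk
  have hkκ : 4 ≤ k * κ := by rw [hk, div_mul_cancel₀ _ hκ.ne']
  have hk0 : 0 < k := by positivity
  have hk4 : 4 ≤ k := by nlinarith
  -- The first term keeps the inner path within `d * ‖v‖ ≤ 1/2`, the second keeps the contour inside
  -- radius `ρ`.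
  set δ := min (1 / (2 * (1 + 2 * k))) (Real.log ρ / 2) with hδ
  have hlogρ : 0 < Real.log ρ := Real.log_pos hρ
  have hδ0 : 0 < δ := lt_min (by positivity) (by positivity)
  have hδk : δ * (1 + 2 * k) ≤ 1 / 2 := by
    have h1 : δ ≤ 1 / (2 * (1 + 2 * k)) := min_le_left _ _
    calc δ * (1 + 2 * k) ≤ 1 / (2 * (1 + 2 * k)) * (1 + 2 * k) := by gcongr
      _ = 1 / 2 := by field_simp
  have hδρ : Real.exp (2 * δ) ≤ ρ := by
    have h1 : δ ≤ Real.log ρ / 2 := min_le_right _ _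
    rw [← Real.le_log_iff_exp_le (by linarith)]
    linarith
  have hδ1 : δ ≤ 1 := by nlinarith
  obtain ⟨A, hA⟩ := exists_nat_ge (W * |ϑ|)
  set b := 1 + 2 * k with hb
  have hb0 : 0 < b := by positivity
  set B := W * (M + Real.exp 1 * C₁) with hB
  have hB0 : 0 ≤ B := by positivity
  set X₀ := Real.exp (Real.pi * A) * (4 ^ A * ((16 * b) ^ (A + 1) * (A + 1).factorial)) *
    (B * Real.exp B) with hX₀
  have hX₀0 : 0 ≤ X₀ := by positivity
  set F := Real.exp (Real.pi * A) * (2 * Real.exp (A * Real.log (ρ + 1) + W * (M * (ρ + 1)) +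
    4 * W * C₂)) with hF
  have hF0 : 0 ≤ F := by positivity
  set C₄ := (A : ℝ) + 4 * W * C₂ with hC₄
  set C' := Real.exp (3 / 2) * (1 + b) + 2 * b with hC'
  refine ⟨C' * X₀ + F, by positivity, ?_⟩
  have ev1 := (hd 0).eventually_le_atBot (-(1 / δ))
  -- This makes `e^{-δ n/d_n} ≤ n^{-(C₄ + A + 2)}`: `C₄` offsets the growth on the outer circle, and
  -- `-(A + 2) ≤ α - 2` leaves the factor `1/n`.
  have ev2 := (hd ((C₄ + A + 2) / δ)).eventually_le_atBot 0
  filter_upwards [ev1, ev2, eventually_ge_atTop 1] with n h1 h2 hn w hw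
  have hn1 : (1 : ℝ) ≤ n := by exact_mod_cast hn
  have hdn1 : (1 : ℝ) ≤ d n := by exact_mod_cast hd1 n
  have hlogn : 0 ≤ Real.log n := Real.log_nonneg hn1
  have hdn : (d n : ℝ) ≤ δ * n := by
    have h3 : 1 / δ ≤ n / d n := by linarith
    rw [div_le_div_iff₀ hδ0 (by linarith)] at h3
    linarith
  have hdn' : d n ≤ n := by
    have : (d n : ℝ) ≤ n := hdn.trans (by nlinarith)
    exact_mod_cast this
  have hwA : ‖w * (ϑ : ℂ)‖ ≤ A := by
    rw [norm_mul, Complex.norm_real, Real.norm_eq_abs]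
    exact (mul_le_mul_of_nonneg_right hw (abs_nonneg _)).trans hA
  set α := (w * (ϑ : ℂ)).re with hα
  have hαA : -(A : ℝ) ≤ α := neg_le_of_abs_le ((Complex.abs_re_le_norm _).trans hwA)
  have hmain := norm_taylorCoeff_le (f := errorFun ϑ q c (D n) w) (n := n) (d := d n)
    (X := X₀ * (d n * Real.exp ((α - 1) * Real.log n))) (M := F * Real.exp (C₄ * Real.log n))
    hρ hκ hκ1 hkκ hδ0 hδk hδρ (differentiableOn_errorFun hκ1.le c (D n) w hqd) (hd1 n) hdn
    (by positivity) (by positivity)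
    (fun v hv hnv hdv => norm_errorFun_le_near hc hM hC₁ hq (hd1 n) (hD n) (hC1 _ (hd1 n)) hw hwA
      hb0 hn hv hnv hdv)
    (fun t ht htn => norm_errorFun_le_far hc hM hC₂ hρ hq (hd1 n) (hD n) (hC2 _ (hd1 n)) hw hwA
      hδ1 hdn hdn' ht htn)
  refine hmain.trans ?_
  have hfar : Real.exp (C₄ * Real.log n) * Real.exp (-(n * (δ / d n))) ≤
      d n / n * Real.exp ((α - 1) * Real.log n) := by
    have h3 : (C₄ + A + 2) * Real.log n ≤ n * (δ / d n) := by
      have h4 : (C₄ + A + 2) / δ * Real.log n ≤ n / d n := by linarith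
      calc (C₄ + A + 2) * Real.log n = δ * ((C₄ + A + 2) / δ * Real.log n) := by field_simp
        _ ≤ δ * (n / d n) := by gcongr
        _ = _ := by ring
    calc Real.exp (C₄ * Real.log n) * Real.exp (-(n * (δ / d n)))
        ≤ Real.exp (-Real.log n + (α - 1) * Real.log n) := by
          rw [← Real.exp_add]
          apply Real.exp_le_exp.2
          nlinarith
      _ = 1 / n * Real.exp ((α - 1) * Real.log n) := by
          rw [Real.exp_add, Real.exp_neg, Real.exp_log (by linarith), one_div]
      _ ≤ _ := by gcongr
  calc C' * (X₀ * (d n * Real.exp ((α - 1) * Real.log n))) / n +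
        F * Real.exp (C₄ * Real.log n) * Real.exp (-(n * (δ / d n)))
      = C' * X₀ * (d n / n) * Real.exp ((α - 1) * Real.log n) +
        F * (Real.exp (C₄ * Real.log n) * Real.exp (-(n * (δ / d n)))) := by ring
    _ ≤ C' * X₀ * (d n / n) * Real.exp ((α - 1) * Real.log n) +
        F * (d n / n * Real.exp ((α - 1) * Real.log n)) := by gcongr
    _ = _ := by ring

/-! ### Asymptotics of the weighted sums -/

/-- The weighted sum over `S_n` as a Taylor coefficient. -/
theorem pow_mul_cycleSum_eq {θ : ℕ → ℝ} {r ϑ K : ℝ} {q : ℂ → ℂ} (hr : 0 < r)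
    (hsum : ∀ z : ℂ, ‖z‖ < 1 → HasSum (fun m : ℕ => ((θ m * r ^ m / m : ℝ) : ℂ) * z ^ m)
      ((ϑ : ℂ) * -Complex.log (1 - z) + K + q z))
    {A D : Finset ℕ} {n : ℕ} (hAD : ∀ m ∈ Finset.Icc 1 n, m ∈ A ↔ m ∉ D) (w : ℂ) :
    (r : ℂ) ^ n * cycleSum (fun m => if m ∈ A then w * θ m else 0) n =
      Complex.exp ((K - L θ D r) * w) *
        (taylorCoeff (errorFun ϑ q (fun m => θ m * r ^ m) D w) n + powCoeff (w * ϑ) n) := by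
  have hr' : (r : ℂ) ≠ 0 := by exact_mod_cast hr.ne'
  set c : ℕ → ℝ := fun m => θ m * r ^ m with hc
  set φ : ℂ → ℂ := fun t => w * ((ϑ : ℂ) * -Complex.log (1 - t) + K + q t -
    ∑ m ∈ D, ((c m / m : ℝ) : ℂ) * t ^ m) with hφ
  set e : ℕ → ℂ := fun m => if m ∈ D then 0 else w * ((c m / m : ℝ) : ℂ) with he
  have hφsum : ∀ t : ℂ, ‖t‖ < 1 → HasSum (fun m : ℕ => e m * t ^ m) (φ t) := by
    intro t ht
    have h1 : HasSum (fun m : ℕ => if m ∈ D then ((c m / m : ℝ) : ℂ) * t ^ m else 0)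
        (∑ m ∈ D, ((c m / m : ℝ) : ℂ) * t ^ m) := by
      have h0 : HasSum (fun m : ℕ => if m ∈ D then ((c m / m : ℝ) : ℂ) * t ^ m else 0)
          (∑ m ∈ D, if m ∈ D then ((c m / m : ℝ) : ℂ) * t ^ m else 0) :=
        hasSum_sum_of_ne_finset_zero fun m hm => if_neg hm
      rwa [Finset.sum_congr rfl (g := fun m : ℕ => ((c m / m : ℝ) : ℂ) * t ^ m)
        (fun m hm => if_pos hm)] at h0
    refine (((hsum t ht).sub h1).mul_left w).congr_fun fun m => ?_
    simp only [he, hc]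
    split_ifs <;> ring
  have hev : ∀ᶠ t in 𝓝 (0 : ℂ), HasSum (fun m : ℕ => e m * t ^ m) (φ t) :=
    eventually_norm_lt_one.mono hφsum
  have hφan : AnalyticAt ℂ φ 0 := (hasFPowerSeriesAt_of_hasSum hev).analyticAt
  have hφ0 : φ 0 = 0 := by
    rw [← taylorCoeff_zero φ, taylorCoeff_of_hasSum hev]
    simp [he]
  set y : ℕ → ℂ := fun j => taylorCoeff (fun t => Complex.exp (φ t)) j / (r : ℂ) ^ j with hy
  -- Only the coefficients of index `1, …, n` enter the recurrence, so it does not matter that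
  -- indices above `n` are never removed from the series.
  have hycs : y n = cycleSum (fun m => if m ∈ A then w * θ m else 0) n := by
    refine eq_cycleSum_of_recurrence _ y n ?_ (fun j hj hjn => ?_) n le_rfl
    · simp [hy, taylorCoeff_zero, hφ0]
    · simp only [hy]
      rw [mul_div_assoc', taylorCoeff_exp_recurrence hφan hj, Finset.sum_div]
      refine Finset.sum_congr rfl fun m hm => ?_
      have hm' := Finset.mem_Icc.1 hm
      have hm0 : (m : ℂ) ≠ 0 := by exact_mod_cast (by omega : m ≠ 0)
      have hpow : (r : ℂ) ^ j = (r : ℂ) ^ m * (r : ℂ) ^ (j - m) := by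
        rw [← pow_add]; congr 1; omega
      have hiff := hAD m (Finset.mem_Icc.2 ⟨hm'.1, hm'.2.trans hjn⟩)
      rw [taylorCoeff_of_hasSum hev, hpow]
      simp only [he, hc]
      by_cases hmD : m ∈ D
      · rw [if_pos hmD, if_neg (fun h => (hiff.1 h) hmD)]
        simp
      · rw [if_neg hmD, if_pos (hiff.2 hmD)]
        push_cast
        have := pow_ne_zero m hr'
        have := pow_ne_zero (j - m) hr'
        field_simp
  have hFan : AnalyticAt ℂ
      (fun t : ℂ => Complex.exp (-((K - L θ D r) * w)) * Complex.exp (φ t)) 0 :=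
    analyticAt_const.mul hφan.cexp'
  have hPan : AnalyticAt ℂ (fun t : ℂ => Complex.exp (w * ϑ * -Complex.log (1 - t))) 0 :=
    (analyticAt_mul_neg_log (w * ϑ)).cexp'
  have hL : (L θ D r : ℂ) = ∑ m ∈ D, ((c m / m : ℝ) : ℂ) := by
    rw [L]
    push_cast
    refine Finset.sum_congr rfl fun m _ => ?_
    simp only [hc]
    push_cast
    ring
  have hfac : (fun t : ℂ => Complex.exp (-((K - L θ D r) * w)) * Complex.exp (φ t)) -
      (fun t : ℂ => Complex.exp (w * ϑ * -Complex.log (1 - t))) = errorFun ϑ q c D w := by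
    funext t
    rw [Pi.sub_apply, errorFun, mul_sub_one, ← Complex.exp_add, ← Complex.exp_add]
    congr 2
    simp only [hφ, shiftedPoly, hL, mul_sub, Finset.sum_sub_distrib, mul_one, sub_mul]
    ring
  have hco := congrArg (fun f => taylorCoeff f n) hfac
  rw [taylorCoeff_sub hFan hPan, taylorCoeff_const_mul] at hco
  rw [← hco, ← hycs, powCoeff, sub_add_cancel, ← mul_assoc, ← Complex.exp_add, add_neg_cancel,
    Complex.exp_zero, one_mul]
  simp only [hy]
  have := pow_ne_zero n hr'
  field_simp

/-- Asymptotics of the weighted sums over `S_n`, uniformly for bounded `w`. -/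
theorem exists_cycleSum_asymptotics {θ : ℕ → ℝ} (hθ : ∀ m : ℕ, 1 ≤ m → 0 ≤ θ m)
    {r ϑ K : ℝ} (hr : 0 < r) (hϑ : 0 < ϑ) (hg : GenFunMem θ r ϑ K) {A : ℕ → Finset ℕ}
    (hd : ∀ C : ℝ, Tendsto
      (fun n : ℕ => C * Real.log (n : ℝ) - (n : ℝ) / (d A n : ℝ)) atTop atBot) {W : ℝ}
    (hW : 0 ≤ W) :
    ∃ C, 0 ≤ C ∧ ∀ᶠ n : ℕ in atTop, ∀ w : ℂ, ‖w‖ ≤ W → ∃ η : ℂ, ‖η‖ ≤ C * (d A n / n) ∧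
      (r : ℂ) ^ n * cycleSum (fun m => if m ∈ A n then w * θ m else 0) n =
        Complex.exp ((K - L θ (D A n) r) * w) *
          Complex.exp ((w * ϑ - 1) * (Real.log n : ℝ)) * ((Complex.Gamma (w * ϑ))⁻¹ + η) := by
  obtain ⟨ρ, κ, M, q, hρ, hκ, hκ1, hM, hqd, hq, hsum⟩ := hg.exists_remainder hr
  set c : ℕ → ℝ := fun m => θ m * r ^ m with hcdef
  have hc : ∀ m, 1 ≤ m → 0 ≤ c m := fun m hm => mul_nonneg (hθ m hm) (by positivity)
  -- The coefficient bounds need only the real segment, where the real part of `q` is the remainder.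
  have hQ : ∀ s : ℝ, 0 < s → s < 1 → |(q ((1 - s : ℝ) : ℂ)).re| ≤ M * s ∧
      HasSum (fun m : ℕ => c m / m * (1 - s) ^ m)
        (-ϑ * Real.log s + K + (q ((1 - s : ℝ) : ℂ)).re) := by
    intro s hs0 hs1
    have hn : ‖((1 - s : ℝ) : ℂ)‖ < 1 := by
      rw [Complex.norm_real, Real.norm_of_nonneg (by linarith)]; linarith
    constructor
    · refine (Complex.abs_re_le_norm _).trans ?_
      have h := hq _ (mem_slitDisc_of_norm_lt_one hρ.le hκ.le hn)
      have e : ((1 - s : ℝ) : ℂ) - 1 = ((-s : ℝ) : ℂ) := by push_cast; ring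
      rwa [e, Complex.norm_real, norm_neg, Real.norm_of_nonneg hs0.le] at h
    · have h := Complex.hasSum_re (hsum _ hn)
      have e : (1 : ℂ) - ((1 - s : ℝ) : ℂ) = ((s : ℝ) : ℂ) := by push_cast; ring
      rw [e, ← Complex.ofReal_log hs0.le] at h
      convert h using 1
      · funext m
        rw [← Complex.ofReal_pow, ← Complex.ofReal_mul, Complex.ofReal_re]
      · simp
  obtain ⟨C₁, hC₁, hC1⟩ := sum_coeff_le hc hϑ.le hM hQ
  obtain ⟨C₂, hC₂, hC2⟩ := sum_coeff_div_le hc hϑ.le hM hQ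
  obtain ⟨C₃, hC₃, hE⟩ := exists_norm_taylorCoeff_errorFun_le (ϑ := ϑ) hρ hκ hκ1 hc hM hW hC₁ hC₂
    hqd hq hC1 hC2 (one_le_d A) (D_subset_Icc_d A) hd
  obtain ⟨C₄, hC₄, hG⟩ := exists_norm_scaledPowCoeff_sub_le (W * ϑ)
  refine ⟨C₃ + C₄, by positivity, ?_⟩
  filter_upwards [hE, eventually_ge_atTop 1] with n hEn hn w hw
  have hn0 : (0 : ℝ) < n := by exact_mod_cast hn
  have hd1 : (1 : ℝ) ≤ d A n := by exact_mod_cast one_le_d A n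
  have hwϑ : ‖w * (ϑ : ℂ)‖ ≤ W * ϑ := by
    rw [norm_mul, Complex.norm_real, Real.norm_of_nonneg hϑ.le]; gcongr
  have hAD : ∀ m ∈ Finset.Icc 1 n, m ∈ A n ↔ m ∉ D A n := by
    intro m hm
    rw [D, Finset.mem_sdiff]
    tauto
  have hexp : Complex.exp ((w * ϑ - 1) * (Real.log n : ℝ)) *
      Complex.exp ((1 - w * ϑ) * (Real.log n : ℝ)) = 1 := by
    rw [← Complex.exp_add, ← add_mul]; simp
  set E := taylorCoeff (errorFun ϑ q c (D A n) w) n with hEdef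
  -- The error collects the rate of convergence to `1/Γ` and the coefficient of `errorFun` divided
  -- by `n^{wϑ-1}`.
  refine ⟨(scaledPowCoeff (w * ϑ) n - (Complex.Gamma (w * ϑ))⁻¹) +
    E * Complex.exp ((1 - w * ϑ) * (Real.log n : ℝ)), ?_, ?_⟩
  · refine (norm_add_le _ _).trans ?_
    have h1 : ‖scaledPowCoeff (w * ϑ) n - (Complex.Gamma (w * ϑ))⁻¹‖ ≤ C₄ * (d A n / n) := by
      refine (hG _ hwϑ n hn).trans ?_
      rw [div_eq_mul_one_div]
      gcongr
    have h2 : ‖E * Complex.exp ((1 - w * ϑ) * (Real.log n : ℝ))‖ ≤ C₃ * (d A n / n) := by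
      have e1 : ‖Complex.exp ((1 - w * ϑ) * (Real.log n : ℝ))‖ =
          Real.exp (-(((w * (ϑ : ℂ)).re - 1) * Real.log n)) := by
        rw [Complex.norm_exp, mul_comm, Complex.re_ofReal_mul, Complex.sub_re, Complex.one_re]
        congr 1
        ring
      rw [norm_mul, e1]
      calc ‖E‖ * Real.exp (-(((w * (ϑ : ℂ)).re - 1) * Real.log n))
          ≤ C₃ * (d A n / n) * Real.exp (((w * (ϑ : ℂ)).re - 1) * Real.log n) *
            Real.exp (-(((w * (ϑ : ℂ)).re - 1) * Real.log n)) := by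
            gcongr
            exact hEn w hw
        _ = C₃ * (d A n / n) := by rw [mul_assoc, ← Real.exp_add, add_neg_cancel]; simp
    linarith
  · rw [pow_mul_cycleSum_eq hr hsum hAD w, scaledPowCoeff]
    linear_combination (-Complex.exp ((K - L θ (D A n) r) * w)) *
      (powCoeff (w * ϑ) n + E) * hexp

/-! ### The quotient of the asymptotics for `w` and for `1` -/

theorem norm_div_add_sub_div_le {g g₁ η η₁ : ℂ} {G H x : ℝ} (hG : 0 < G) (hgG : g = G)
    (hg₁ : ‖g₁‖ ≤ H) (hη : ‖η‖ ≤ x) (hη₁ : ‖η₁‖ ≤ x) (hx : x ≤ G / 2) :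
    ‖(g₁ + η₁) / (g + η) - g₁ / g‖ ≤ (G + H) * 2 / G ^ 2 * x := by
  subst hgG
  have hGc : (G : ℂ) ≠ 0 := by exact_mod_cast hG.ne'
  have hden : G / 2 ≤ ‖(G : ℂ) + η‖ := by
    have h := norm_sub_norm_le (G : ℂ) (-η)
    rw [norm_neg, sub_neg_eq_add, Complex.norm_real, Real.norm_of_nonneg hG.le] at h
    linarith
  have hne : (G : ℂ) + η ≠ 0 := by
    rw [← norm_pos_iff]; linarith
  have hx0 : 0 ≤ x := (norm_nonneg _).trans hη
  have hH : 0 ≤ H := (norm_nonneg _).trans hg₁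
  have e : (g₁ + η₁) / (G + η) - g₁ / G = (G * η₁ - g₁ * η) / ((G + η) * G) := by
    field_simp; ring
  rw [e, norm_div, norm_mul, Complex.norm_real, Real.norm_of_nonneg hG.le,
    div_le_iff₀ (by positivity)]
  have hnum : ‖(G : ℂ) * η₁ - g₁ * η‖ ≤ (G + H) * x := by
    refine (norm_sub_le _ _).trans ?_
    rw [norm_mul, norm_mul, Complex.norm_real, Real.norm_of_nonneg hG.le, add_mul]
    gcongr
  calc ‖(G : ℂ) * η₁ - g₁ * η‖ ≤ (G + H) * x := hnum
    _ = (G + H) * 2 / G ^ 2 * x * (G / 2 * G) := by field_simp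
    _ ≤ _ := by gcongr

end AWeighted

theorem mainTheorem5 (θ : ℕ → ℝ) (hθ : ∀ m : ℕ, 1 ≤ m → 0 ≤ θ m)
    (r ϑ K : ℝ) (hr : 0 < r) (hϑ : 0 < ϑ)
    (hg : AWeighted.GenFunMem θ r ϑ K)
    (A : ℕ → Finset ℕ) (hA : ∀ n : ℕ, A n ⊆ Finset.Icc 1 n)
    (hd : ∀ C : ℝ, Tendsto
      (fun n : ℕ => C * Real.log (n : ℝ) - (n : ℝ) / (AWeighted.d A n : ℝ)) atTop atBot) :
    ∀ B : ℝ, ∃ (C : ℝ) (N : ℕ), ∀ n : ℕ, N ≤ n →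
      0 < AWeighted.h θ (A n) n ∧
      ∀ s : ℂ, |(Complex.I * s).re| ≤ B →
        ∃ ε : ℂ, ‖ε‖ ≤ C * ((AWeighted.d A n : ℝ) / (n : ℝ)) ∧
          AWeighted.expect θ (A n) (fun σ : Equiv.Perm (Fin n) =>
              Complex.exp (Complex.I * s * (AWeighted.totalCycles σ : ℂ))) =
            (n : ℂ) ^ ((ϑ : ℂ) * (Complex.exp (Complex.I * s) - 1)) *
              Complex.exp (((K : ℂ) - (AWeighted.L θ (AWeighted.D A n) r : ℂ)) *
                (Complex.exp (Complex.I * s) - 1)) *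
              (Complex.Gamma (ϑ : ℂ) / Complex.Gamma (Complex.exp (Complex.I * s) * (ϑ : ℂ)) + ε) := by
  intro B
  -- The radius covers both `w = e^{is}` and the normalization `w = 1`.
  set W := max 1 (Real.exp B) with hW
  have hW1 : 1 ≤ W := le_max_left _ _
  obtain ⟨C, hC, hev⟩ := AWeighted.exists_cycleSum_asymptotics hθ hr hϑ hg hd
    (zero_le_one.trans hW1)
  set G := (Real.Gamma ϑ)⁻¹ with hG
  have hG0 : 0 < G := inv_pos.2 (Real.Gamma_pos_of_pos hϑ)
  have hGc : (Complex.Gamma (ϑ : ℂ))⁻¹ = G := by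
    rw [Complex.Gamma_ofReal, hG, Complex.ofReal_inv]
  obtain ⟨H, hH⟩ := (isCompact_closedBall (0 : ℂ) (W * ϑ)).exists_bound_of_continuousOn
    Complex.differentiable_one_div_Gamma.continuous.continuousOn
  -- The growth hypothesis with `C = 0` gives `d_n / n → 0`, which keeps the denominator `G + η` at
  -- least `G / 2` in modulus.
  have hsmall : ∀ᶠ n : ℕ in atTop, C * ((AWeighted.d A n : ℝ) / n) ≤ G / 2 := by
    filter_upwards [(hd 0).eventually_le_atBot (-(2 * C / G)), eventually_ge_atTop 1] with n h1 hn
    have hn0 : (0 : ℝ) < n := by exact_mod_cast hn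
    have hd0 : (0 : ℝ) < AWeighted.d A n := by exact_mod_cast AWeighted.one_le_d A n
    have h2 : 2 * C / G ≤ n / AWeighted.d A n := by linarith
    rw [div_le_div_iff₀ hG0 hd0] at h2
    rw [mul_div_assoc', div_le_div_iff₀ hn0 (by norm_num)]
    linarith
  obtain ⟨N, hN⟩ := eventually_atTop.1 (hev.and (hsmall.and (eventually_ge_atTop 1)))
  refine ⟨(G + H) * 2 / G ^ 2 * C, N, fun n hn => ?_⟩
  obtain ⟨hasym, hsm, hn1⟩ := hN n hn
  have hn0 : (0 : ℝ) < n := by exact_mod_cast hn1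
  have hnc : (n : ℂ) ≠ 0 := by exact_mod_cast hn0.ne'
  have hrn : (r : ℂ) ^ n ≠ 0 := pow_ne_zero _ (by exact_mod_cast hr.ne')
  set κ := (K : ℂ) - (AWeighted.L θ (AWeighted.D A n) r : ℂ) with hκ
  obtain ⟨η, hη, hηeq⟩ := hasym 1 (by simpa using hW1)
  simp only [one_mul, mul_one] at hηeq
  rw [← AWeighted.ofReal_h, hGc] at hηeq
  have hηG : ‖η‖ ≤ G / 2 := hη.trans hsm
  -- Up to positive real factors `h` is `G + η`, whose real part is at least `G / 2`.
  have hpos : 0 < AWeighted.h θ (A n) n := by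
    have e1 : Complex.exp κ * Complex.exp (((ϑ : ℂ) - 1) * (Real.log n : ℝ)) =
        ((Real.exp (K - AWeighted.L θ (AWeighted.D A n) r) *
          Real.exp ((ϑ - 1) * Real.log n) : ℝ) : ℂ) := by
      rw [hκ]; push_cast; rfl
    have h1 := congrArg Complex.re hηeq
    rw [e1, ← Complex.ofReal_pow, ← Complex.ofReal_mul, Complex.ofReal_re, Complex.re_ofReal_mul,
      Complex.add_re, Complex.ofReal_re] at h1
    have h2 : 0 < G + η.re := by
      have := neg_le_of_abs_le ((Complex.abs_re_le_norm η).trans hηG)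
      linarith
    have h3 : 0 < r ^ n * AWeighted.h θ (A n) n := by
      rw [h1]; positivity
    exact pos_of_mul_pos_right h3 (by positivity)
  refine ⟨hpos, fun s hs => ?_⟩
  set w := Complex.exp (Complex.I * s) with hw
  have hwW : ‖w‖ ≤ W := by
    rw [hw, Complex.norm_exp]
    exact (Real.exp_le_exp.2 (le_of_abs_le hs)).trans (le_max_right _ _)
  obtain ⟨η₁, hη₁, hη₁eq⟩ := hasym w hwW
  have hwϑ : w * (ϑ : ℂ) ∈ Metric.closedBall (0 : ℂ) (W * ϑ) := by
    rw [mem_closedBall_zero_iff, norm_mul, Complex.norm_real, Real.norm_of_nonneg hϑ.le]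
    gcongr
  have hden : (G : ℂ) + η ≠ 0 := by
    intro h0
    rw [h0, mul_zero] at hηeq
    have : (AWeighted.h θ (A n) n : ℂ) = 0 := by
      rcases mul_eq_zero.1 hηeq with h | h
      · exact absurd h hrn
      · exact h
    exact hpos.ne' (by exact_mod_cast this)
  refine ⟨((Complex.Gamma (w * ϑ))⁻¹ + η₁) / (G + η) - (Complex.Gamma (w * ϑ))⁻¹ / G, ?_, ?_⟩
  · rw [mul_assoc]
    exact AWeighted.norm_div_add_sub_div_le hG0 rfl (hH _ hwϑ) hη hη₁ hsm
  -- At a pole of `Γ` both sides vanish by the convention for division by zero, in agreement with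
  -- the entire function `1/Γ`.
  · have hΓ : Complex.Gamma (ϑ : ℂ) / Complex.Gamma (w * ϑ) = (Complex.Gamma (w * ϑ))⁻¹ / G := by
      rw [← hGc, div_inv_eq_mul, div_eq_mul_inv, mul_comm (Complex.Gamma (ϑ : ℂ))]
    rw [hΓ, add_sub_cancel, AWeighted.expect_exp_eq, ← hw]
    have hlog : ((Real.log n : ℝ) : ℂ) = Complex.log n := by
      rw [Complex.ofReal_log (Nat.cast_nonneg _), Complex.ofReal_natCast]
    -- The prefactor of the theorem is the quotient of the main factors for `w` and for `1`.
    have hcpow : (n : ℂ) ^ ((ϑ : ℂ) * (w - 1)) * Complex.exp (κ * (w - 1)) *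
        (Complex.exp κ * Complex.exp (((ϑ : ℂ) - 1) * (Real.log n : ℝ))) =
        Complex.exp (κ * w) * Complex.exp ((w * ϑ - 1) * (Real.log n : ℝ)) := by
      rw [Complex.cpow_def_of_ne_zero hnc, ← hlog]
      simp only [← Complex.exp_add]
      congr 1
      ring
    have hh : (AWeighted.h θ (A n) n : ℂ) ≠ 0 := by exact_mod_cast hpos.ne'
    rw [← mul_div_assoc, div_eq_div_iff hh hden]
    apply mul_left_cancel₀ hrn
    linear_combination ((G : ℂ) + η) * hη₁eq - ((n : ℂ) ^ ((ϑ : ℂ) * (w - 1)) *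
      Complex.exp (κ * (w - 1)) * ((Complex.Gamma (w * ϑ))⁻¹ + η₁)) * hηeq -
      ((Complex.Gamma (w * ϑ))⁻¹ + η₁) * ((G : ℂ) + η) * hcpow
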